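/- Let $d_1,d_2\ge 1$, $d=d_1+d_2$, and let $(\mathcal E_n)_{n\in\mathbb Z^d}$ be complex coefficients with $\mathcal E_n=\overline{\mathcal E_{-n}}$ and $|\mathcal E_n|\le C e^{-a|n|}$ for some $C$ and some $a>0$. Let $H_0=\sum_{n}\mathcal E_nU_n$ on $\ell^2(\mathbb Z^d)$, where $(U_n\phi)_m=\phi_{m-n}$, and let $\mathcal E(k)=\sum_n\mathcal E_ne^{\imath n\cdot k}$ be its real-valued symbol on $\mathbb T^d=(\mathbb R/2\pi\mathbb Z)^d$, with $E_-=\min\mathcal E$ and $E_+=\max\mathcal E$. Let $\Lambda=\mathbb Z^{d_1}\times\{0\}\subset\mathbb Z^d$, let $\Pi:\ell^2(\mathbb Z^d)\to\ell^2(\Lambda)\cong\ell^2(\mathbb Z^{d_1})$ be the restriction to $\Lambda$, and for $z\notin\mathbb R$ set $G_0^\Lambda(z)=\Pi(z-H_0)^{-1}\Pi^*$. For $E\in\mathbb R$ let $G_0^\Lambda(E\pm\imath 0)$ be the weak limit of $G_0^\Lambda(E\pm\imath\epsilon)$ as $\epsilon\downarrow0$, with domain the set of all $v\in\ell^2(\mathbb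 Z^{d_1})$ for which $G_0^\Lambda(E\pm\imath\epsilon)v$ converges weakly in $\ell^2(\mathbb Z^{d_1})$, and let $\Im m\,G_0^\Lambda(E-\imath0)$ be the closure of $\frac1{2\imath}\bigl(G_0^\Lambda(E-\imath0)-G_0^\Lambda(E+\imath0)\bigr)$, defined on the intersection of the two domains. (If the weak limits exist on all of $\ell^2(\mathbb Z^{d_1})$, this is the usual bounded imaginary part; in general it may be unbounded.) Let $E\in(E_-,E_+)$ be non-critical, that is, $\nabla\mathcal E(k)\ne0$ for every $k\in\Sigma_E=\{k\in\mathbb T^d:\mathcal E(k)=E\}$, and let $$\Sigma_{E,1}=\{k_1\in\mathbb T^{d_1}:\ \text{there is }k_2\in\mathbb T^{d_2}\text{ with }(k_1,k_2)\in\Sigma_E\}.$$ Then $\Im m\,G_0^\Lambda(E-\imath0)$ is a (densely defined) self-adjoint operator on $\ell^2(\mathbb Z^{d_1})$. Denote by $\mathcal F^\Lambda$ the closure of its range and by $P^\Lambda$ the orthogonal projection of $\ell^2(\mathbb Z^{d_1})$ onto $\mathcal F^\Lambda$ (these are also written $\mathcal F_b^\Lambda$ and $P_b^\Lambda$, with $b=\frac12\ln\frac{E-E_-}{E_+-E}$).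 Then $$(\mathcal F^\Lambda)^\perp=\mathrm{Ker}\,\Im m\,G_0^\Lambda(E-\imath0)=\bigl\{v\in\ell^2(\mathbb Z^{d_1}):\ \hat v(k_1)=0\text{ for almost all }k_1\in\Sigma_{E,1}\bigr\},$$ where $\hat v(k_1)=\sum_{n_1\in\mathbb Z^{d_1}}v_{n_1}e^{\imath n_1\cdot k_1}$ (convergence in $L^2(\mathbb T^{d_1})$). Moreover, with $\mathcal F_1:\ell^2(\mathbb Z^{d_1})\to L^2(\mathbb T^{d_1})$ the unitary Fourier transform, $\mathcal F_1P^\Lambda\mathcal F_1^*$ is the operator of multiplication by the indicator function $\chi_{\Sigma_{E,1}}$. Equivalently, the projection $1-P^\Lambda$ onto the kernel is multiplication by $1-\chi_{\Sigma_{E,1}}$. -/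

import Mathlib

open MeasureTheory Filter Topology
open scoped ENNReal ComplexConjugate

noncomputable section

namespace LatticeGreen

/-! ### The lattice Hilbert spaces -/

/-- The Hilbert space `ℓ²(ℤ^ι)`. -/
abbrev SeqSpace (ι : Type) : Type := lp (fun _ : ι → ℤ => ℂ) 2

/-- Pull-back `φ ↦ φ ∘ σ` of square summable sequences along an injective map `σ`. -/
def pullback {ι κ : Type} (σ : (ι → ℤ) → (κ → ℤ)) (hσ : Function.Injective σ) :
    SeqSpace κ →L[ℂ] SeqSpace ι :=
  have hmem : ∀ φ : SeqSpace κ, Memℓp (fun n => φ (σ n)) 2 := fun φ => by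
    have h := (memℓp_gen_iff (p := 2) (by norm_num)).1 (lp.memℓp φ)
    exact (memℓp_gen_iff (p := 2) (by norm_num)).2 (h.comp_injective hσ)
  LinearMap.mkContinuous
    { toFun := fun φ => ⟨fun n => φ (σ n), hmem φ⟩
      map_add' := fun _ _ => rfl
      map_smul' := fun _ _ => rfl } 1 (fun φ => by
    have h := (memℓp_gen_iff (p := 2) (by norm_num)).1 (lp.memℓp φ)
    rw [one_mul]
    refine le_of_sq_le_sq ?_ (norm_nonneg _)
    have e1 := lp.norm_rpow_eq_tsum (p := 2) (by norm_num)
      (⟨fun n => φ (σ n), hmem φ⟩ : SeqSpace ι)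
    have e2 := lp.norm_rpow_eq_tsum (p := 2) (by norm_num) φ
    norm_num at e1 e2 h
    refine e1.trans_le (le_of_le_of_eq ?_ e2.symm)
    exact tsum_comp_le_tsum_of_inj h (fun _ => by positivity) hσ)

/-- The translation operator `U_n` on `ℓ²(ℤ^ι)`: `(U_n φ)_m = φ_{m - n}`. -/
def shift {ι : Type} (n : ι → ℤ) : SeqSpace ι →L[ℂ] SeqSpace ι :=
  pullback (fun m => m - n) (sub_left_injective)

/-! ### The translation invariant operator and its symbol -/

/-- Exponential decay of the coefficients: `|c_n| ≤ C e^{-a |n|}` for some `a > 0`. -/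
def ExpDecay {ι : Type} [Fintype ι] (c : (ι → ℤ) → ℂ) : Prop :=
  ∃ C a : ℝ, 0 < a ∧ ∀ n, ‖c n‖ ≤ C * Real.exp (-(a * ‖n‖))

/-- The symmetry `c_n = conj c_{-n}`. -/
def HermitianCoeff {ι : Type} (c : (ι → ℤ) → ℂ) : Prop :=
  ∀ n, c n = conj (c (-n))

/-- `H₀ = ∑_n c_n U_n` on `ℓ²(ℤ^ι)` (a norm convergent series). -/
def freeHamiltonian {ι : Type} (c : (ι → ℤ) → ℂ) : SeqSpace ι →L[ℂ] SeqSpace ι :=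
  ∑' n, c n • shift n

/-- The symbol `∑_n c_n e^{i n·k}` as a function on the torus. The torus is parametrized by
`x = k / 2π ∈ (ℝ/ℤ)^ι`, so that `UnitAddTorus.mFourier n x = e^{i n·k}`.
The sum is real for Hermitian coefficients. -/
def symbol {ι : Type} [Fintype ι] (c : (ι → ℤ) → ℂ) (x : UnitAddTorus ι) : ℝ :=
  (∑' n, c n * UnitAddTorus.mFourier n x).re

/-- The symbol as a periodic function on `ℝ^ι`. -/
def symbolLift {ι : Type} [Fintype ι] (c : (ι → ℤ) → ℂ) (x : ι → ℝ) : ℝ :=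
  symbol c (fun j => (x j : UnitAddCircle))

/-- `E` is non-critical: the gradient of the symbol vanishes nowhere on the level set of `E`. -/
def NonCritical {ι : Type} [Fintype ι] (c : (ι → ℤ) → ℂ) (E : ℝ) : Prop :=
  ∀ x : ι → ℝ, symbolLift c x = E → fderiv ℝ (symbolLift c) x ≠ 0

/-- `E₋`, the minimum of the symbol. -/
def bandMin {ι : Type} [Fintype ι] (c : (ι → ℤ) → ℂ) : ℝ := ⨅ x, symbol c x

/-- `E₊`, the maximum of the symbol. -/
def bandMax {ι : Type} [Fintype ι] (c : (ι → ℤ) → ℂ) : ℝ := ⨆ x, symbol c x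

/-- The level surface `Σ_E` in the torus. -/
def levelSurface {ι : Type} [Fintype ι] (c : (ι → ℤ) → ℂ) (E : ℝ) : Set (UnitAddTorus ι) :=
  {x | symbol c x = E}

/-! ### Limits of operators -/

section Limits

variable {H : Type*} [NormedAddCommGroup H] [InnerProductSpace ℂ H]

/-- The pairs `(v, w)` such that `A_ε v → w` weakly as `ε ↓ 0`. -/
def weakLimitGraph (A : ℝ → H →L[ℂ] H) : Submodule ℂ (H × H) where
  carrier := {p | ∀ u : H, Tendsto (fun ε : ℝ => inner ℂ u (A ε p.1)) (𝓝[>] 0) (𝓝 (inner ℂ u p.2))}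
  add_mem' := fun {p q} hp hq u => by
    simpa [inner_add_right] using (hp u).add (hq u)
  zero_mem' := fun u => by simp
  smul_mem' := fun a p hp u => by
    simpa [inner_smul_right] using (hp u).const_mul a

/-- The weak limit of the operators `A_ε` as `ε ↓ 0`. Its domain consists of all `v` for which
`A_ε v` converges weakly. -/
def weakLimit (A : ℝ → H →L[ℂ] H) : H →ₗ.[ℂ] H := (weakLimitGraph A).toLinearPMap

theorem weakLimit_graph (A : ℝ → H →L[ℂ] H) : (weakLimit A).graph = weakLimitGraph A := by
  refine Submodule.toLinearPMap_graph_eq _ ?_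
  rintro ⟨v, w⟩ h hv
  have hv' : v = 0 := hv
  subst hv'
  have h1 := h w
  simp only [map_zero, inner_zero_right] at h1
  exact inner_self_eq_zero.1 (tendsto_nhds_unique h1 tendsto_const_nhds)

/-- The kernel of a partially defined operator. -/
def kernel (T : H →ₗ.[ℂ] H) : Submodule ℂ H := T.graph.comap (LinearMap.inl ℂ H H)

/-- The closure of the range of a partially defined operator. -/
def closedRange (T : H →ₗ.[ℂ] H) : Submodule ℂ H := (LinearMap.range T.toFun).topologicalClosure

instance [CompleteSpace H] (T : H →ₗ.[ℂ] H) : CompleteSpace (closedRange T) :=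
  inferInstanceAs (CompleteSpace (LinearMap.range T.toFun).topologicalClosure)

end Limits

/-! ### The surface `Λ = ℤ^{d₁} × {0}` -/

variable {d₁ d₂ : ℕ}

/-- The inclusion `n₁ ↦ (n₁, 0)` of `ℤ^{d₁}` into `ℤ^{d₁} × ℤ^{d₂}`. -/
def surfaceIncl (d₁ d₂ : ℕ) (n : Fin d₁ → ℤ) : Fin d₁ ⊕ Fin d₂ → ℤ := Sum.elim n 0

theorem surfaceIncl_injective (d₁ d₂ : ℕ) : Function.Injective (surfaceIncl d₁ d₂) :=
  fun _ _ h => funext fun i => congrFun h (Sum.inl i)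

/-- The partial isometry `Π` from `ℓ²(ℤ^d)` onto `ℓ²(Λ)`, with `ℓ²(Λ)` identified with
`ℓ²(ℤ^{d₁})`. -/
def surfaceProj (d₁ d₂ : ℕ) : SeqSpace (Fin d₁ ⊕ Fin d₂) →L[ℂ] SeqSpace (Fin d₁) :=
  pullback (surfaceIncl d₁ d₂) (surfaceIncl_injective d₁ d₂)

/-- The restricted free resolvent `Π (z - H₀)⁻¹ Π*`. -/
def greenRestricted (c : (Fin d₁ ⊕ Fin d₂ → ℤ) → ℂ) (z : ℂ) :
    SeqSpace (Fin d₁) →L[ℂ] SeqSpace (Fin d₁) :=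
  (surfaceProj d₁ d₂) ∘L (resolvent (freeHamiltonian c) z) ∘L
    (ContinuousLinearMap.adjoint (surfaceProj d₁ d₂))

/-- The weak boundary value `G₀^Λ(E - i0)`. -/
def greenMinus (c : (Fin d₁ ⊕ Fin d₂ → ℤ) → ℂ) (E : ℝ) :
    SeqSpace (Fin d₁) →ₗ.[ℂ] SeqSpace (Fin d₁) :=
  weakLimit fun ε => greenRestricted c ((E : ℂ) - (ε : ℂ) * Complex.I)

/-- The weak boundary value `G₀^Λ(E + i0)`. -/
def greenPlus (c : (Fin d₁ ⊕ Fin d₂ → ℤ) → ℂ) (E : ℝ) :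
    SeqSpace (Fin d₁) →ₗ.[ℂ] SeqSpace (Fin d₁) :=
  weakLimit fun ε => greenRestricted c ((E : ℂ) + (ε : ℂ) * Complex.I)

/-- `Im G₀^Λ(E - i0)`: the closure of `(G₀^Λ(E - i0) - G₀^Λ(E + i0)) / 2i`, where
`G₀^Λ(E + iε)` is the adjoint of `G₀^Λ(E - iε)`. If the weak limits exist on all of
`ℓ²(ℤ^{d₁})`, this is the bounded imaginary part. -/
def imGreen (c : (Fin d₁ ⊕ Fin d₂ → ℤ) → ℂ) (E : ℝ) :
    SeqSpace (Fin d₁) →ₗ.[ℂ] SeqSpace (Fin d₁) :=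
  ((1 / (2 * Complex.I) : ℂ) • (greenMinus c E - greenPlus c E)).closure

/-- The projection `Σ_{E,1}` of the level surface onto the first `d₁` coordinates. -/
def levelProjection (c : (Fin d₁ ⊕ Fin d₂ → ℤ) → ℂ) (E : ℝ) : Set (UnitAddTorus (Fin d₁)) :=
  {x₁ | ∃ x₂ : UnitAddTorus (Fin d₂), (Sum.elim x₁ x₂ : UnitAddTorus (Fin d₁ ⊕ Fin d₂)) ∈
    levelSurface c E}

/-- The subspace `𝓕_b^Λ = Ran Im G₀^Λ(E - i0)` (closed), `b = f(E)`. -/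
def surfaceRange (c : (Fin d₁ ⊕ Fin d₂ → ℤ) → ℂ) (E : ℝ) : Submodule ℂ (SeqSpace (Fin d₁)) :=
  closedRange (imGreen c E)

instance (c : (Fin d₁ ⊕ Fin d₂ → ℤ) → ℂ) (E : ℝ) : CompleteSpace (surfaceRange c E) :=
  inferInstanceAs (CompleteSpace (closedRange (imGreen c E)))

/-- The orthogonal projection `P_b^Λ` in `ℓ²(ℤ^{d₁})` onto `𝓕_b^Λ`. -/
def surfaceRangeProj (c : (Fin d₁ ⊕ Fin d₂ → ℤ) → ℂ) (E : ℝ) :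
    SeqSpace (Fin d₁) →L[ℂ] SeqSpace (Fin d₁) :=
  (surfaceRange c E).starProjection

/-! ### Fourier transform along the surface -/

/-- Normalized Haar measure on the torus. -/
abbrev torusMeasure (ι : Type) [Fintype ι] : Measure (UnitAddTorus ι) :=
  Measure.pi fun _ => AddCircle.haarAddCircle

/-- The unitary Fourier transform `v ↦ v̂ = ∑_n v_n e^{i n·k}` (series converging in `L²`). With
the normalized Haar measure it needs no power of `2π`. -/
def fourierTransform (ι : Type) [Fintype ι] :
    SeqSpace ι ≃ₗᵢ[ℂ] Lp ℂ 2 (torusMeasure ι) :=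
  (UnitAddTorus.mFourierBasis (d := ι)).repr.symm

end LatticeGreen

end

/-! The Fourier transform along `Λ` turns `greenRestricted c z` into multiplication by `fibreGreen c
z`, the integral of `(z - symbol)⁻¹` over the fibre above `k₁` (`inner_greenRestricted`). Hence
`imGreen` should be multiplication by `h = -Im g₀`, where `g₀(k₁)` is the limit of `fibreGreen` at
`E + iε`. The theorem follows once `g₀` is known to exist almost everywhere, with bounds on large
sets, and `h` is known to vanish exactly off `Σ_{E,1}`, up to a null set.

Existence. A level that is non-critical on the whole torus can still be critical for the symbol
restricted to a fibre. The exceptional `k₁` are critical values of the projection of `Σ_E` to the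
first coordinates, so they form a null set (`torusMeasure_criticalFibres`). Working on lines
parallel to the axes and then using Fubini reduces this to Sard's theorem for real-valued functions
(`exists_sard`). The remaining `k₁` are exhausted by the closed sets `regularSet c E n`. There, two
integrations by parts along the fibre replace `1/w` by `w log w - w` plus bounded remainders, which
gives uniform bounds and limits (`fibreGreen_boundaryValues`).

Zero set. The imaginary part of `fibreGreen` at `E + iε` is minus a fibre integral of Poisson
kernels. It tends to `0` if the fibre misses `Σ_E` (`tendsto_im_fibreGreen_of_notMem`), and it stays
away from `0` if a regular fibre meets `Σ_E` (`im_limit_neg`).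

Operators. `g₀` need not be bounded, so the weak limits may be defined only on part of the space.
Vectors whose transform is supported in one of the regular sets belong to both domains and form a
core of the maximal multiplication operator by `h`. The closure is therefore this self-adjoint
operator (`graph_closure_imaginaryPart`, `isSelfAdjoint_of_graph_eq`). Its kernel consists of the
`v` whose transform vanishes where `h ≠ 0`, and this kernel is the orthogonal complement of the
range. -/

noncomputable section

namespace LatticeGreen

/-! ### Sard's theorem for real-valued functions -/

section Sard

universe u

open scoped NNReal

variable {V : Type u} [NormedAddCommGroup V] [NormedSpace ℝ V]

/-- Near a point, differences of values of a `C^{k+1}` function at points where the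
derivatives of order `1, …, k` vanish are `O(|x - y|^{k+1})`. -/
theorem exists_norm_sub_le_pow {f : V → ℝ} {a : V} {k : ℕ} (hf : ContDiffAt ℝ (k + 1 : ℕ) f a) :
    ∃ C : ℝ, 0 ≤ C ∧ ∃ U ∈ 𝓝 a, ∀ x ∈ U, ∀ y ∈ U,
      (∀ i, 1 ≤ i → i ≤ k → iteratedFDeriv ℝ i f x = 0) → |f y - f x| ≤ C * ‖y - x‖ ^ (k + 1) := by
  have h1 : ∀ᶠ x in 𝓝 a, ContDiffAt ℝ (k + 1 : ℕ) f x := hf.eventually (by simp)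
  have h2 : ∀ᶠ x in 𝓝 a, ‖iteratedFDeriv ℝ (k + 1) f x‖ < ‖iteratedFDeriv ℝ (k + 1) f a‖ + 1 :=
    (hf.continuousAt_iteratedFDeriv (by exact_mod_cast le_rfl)).norm.eventually_lt_const (by simp)
  obtain ⟨r, hr, hball⟩ := Metric.eventually_nhds_iff_ball.1 (h1.and h2)
  set C := ‖iteratedFDeriv ℝ (k + 1) f a‖ + 1
  have hC : 0 ≤ C := by positivity
  -- Descent through the orders, starting from the bound `C` on the top derivative. The derivative
  -- of order `k - i` vanishes at `x`, so the mean value inequality on the segment from `x` gains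
  -- one factor `‖y - x‖` each time. The constant does not depend on `x`.
  have key : ∀ x ∈ Metric.ball a r, (∀ i, 1 ≤ i → i ≤ k → iteratedFDeriv ℝ i f x = 0) →
      ∀ i ≤ k, ∀ y ∈ Metric.ball a r, ‖iteratedFDeriv ℝ (k + 1 - i) f y‖ ≤ C * ‖y - x‖ ^ i := by
    intro x hx hz i
    induction i with
    | zero => intro _ y hy; simpa using (hball y hy).2.le
    | succ i ih =>
      intro hi y hy
      have hd : ∀ w ∈ segment ℝ x y, DifferentiableAt ℝ (iteratedFDeriv ℝ (k - i) f) w := by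
        intro w hw
        have hwb := (convex_ball a r).segment_subset hx hy hw
        refine (hball w hwb).1.differentiableAt_iteratedFDeriv ?_
        exact_mod_cast (by omega : k - i < k + 1)
      have hb : ∀ w ∈ segment ℝ x y, ‖fderiv ℝ (iteratedFDeriv ℝ (k - i) f) w‖ ≤ C * ‖y - x‖ ^ i := by
        intro w hw
        have hwb := (convex_ball a r).segment_subset hx hy hw
        rw [norm_fderiv_iteratedFDeriv, show k - i + 1 = k + 1 - i by omega]
        refine (ih (by omega) w hwb).trans ?_
        have : ‖w - x‖ ≤ ‖y - x‖ := by
          obtain ⟨t, ht, rfl⟩ := (segment_eq_image' ℝ x y).subset hw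
          rw [add_sub_cancel_left, norm_smul, Real.norm_eq_abs, abs_of_nonneg ht.1]
          exact mul_le_of_le_one_left (norm_nonneg _) ht.2
        gcongr
      have := (convex_segment x y).norm_image_sub_le_of_norm_fderiv_le hd hb
        (left_mem_segment ℝ x y) (right_mem_segment ℝ x y)
      rw [hz (k - i) (by omega) (by omega), sub_zero] at this
      rw [show k + 1 - (i + 1) = k - i by omega, pow_succ, ← mul_assoc]
      exact this
  refine ⟨C, hC, _, Metric.ball_mem_nhds a hr, fun x hx y hy hz => ?_⟩
  have hd : ∀ w ∈ segment ℝ x y, DifferentiableAt ℝ f w := by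
    intro w hw
    have hwb := (convex_ball a r).segment_subset hx hy hw
    exact (hball w hwb).1.differentiableAt (by simp)
  have hb : ∀ w ∈ segment ℝ x y, ‖fderiv ℝ f w‖ ≤ C * ‖y - x‖ ^ k := by
    intro w hw
    have hwb := (convex_ball a r).segment_subset hx hy hw
    have h := key x hx hz k le_rfl w hwb
    rw [show k + 1 - k = 1 by omega, norm_iteratedFDeriv_one] at h
    refine h.trans ?_
    have : ‖w - x‖ ≤ ‖y - x‖ := by
      obtain ⟨t, ht, rfl⟩ := (segment_eq_image' ℝ x y).subset hw
      rw [add_sub_cancel_left, norm_smul, Real.norm_eq_abs, abs_of_nonneg ht.1]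
      exact mul_le_of_le_one_left (norm_nonneg _) ht.2
    gcongr
  have := (convex_segment x y).norm_image_sub_le_of_norm_fderiv_le hd hb
    (left_mem_segment ℝ x y) (right_mem_segment ℝ x y)
  rw [pow_succ, ← mul_assoc]
  exact this

variable [FiniteDimensional ℝ V]


/-- A regular level set of a `C^N` function is locally parametrized by a `C^N` map on the kernel of
the derivative. -/
theorem exists_levelSet_chart {N : ℕ} (hN : N ≠ 0) {g : V → ℝ} {a : V} (hg : ContDiffAt ℝ N g a)
    (hg' : fderiv ℝ g a ≠ 0) :
    ∃ (ψ : (fderiv ℝ g a).ker → V) (W : Set (fderiv ℝ g a).ker), IsOpen W ∧ ContDiffOn ℝ N ψ W ∧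
      (∀ y ∈ W, g (ψ y) = g a) ∧ ∃ U ∈ 𝓝 a, ∀ x ∈ U, g x = g a → ∃ y ∈ W, ψ y = x := by
  have hN' : (N : WithTop ℕ∞) ≠ 0 := by exact_mod_cast hN
  have hs := hg.hasStrictFDerivAt hN'
  have hr : (fderiv ℝ g a).range = ⊤ := by
    refine LinearMap.range_eq_top.2 (LinearMap.surjective ?_)
    intro h
    exact hg' (by ext v; exact DFunLike.congr_fun h v)
  have hker : (fderiv ℝ g a).ker.ClosedComplemented := Submodule.ClosedComplemented.of_finiteDimensional _
  set φ := HasStrictFDerivAt.implicitFunctionDataOfComplemented g (fderiv ℝ g a) hs hr hker with hφ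
  have hpt : φ.prodFun φ.pt = (g a, 0) := by
    simp [hφ, ImplicitFunctionData.prodFun]
  have hright : ContDiff ℝ N φ.rightFun := by
    -- The second component of the implicit function data is a linear projection of `x - a` onto the
    -- kernel, hence smooth. The kernel coordinate thus serves as the parameter of the level set.
    change ContDiff ℝ N (fun x => Classical.choose hker (x - a))
    fun_prop
  have hc := φ.contDiffAt_implicitFunction (n := N) hg hright.contDiffAt hN'
  rw [hpt] at hc
  have hc2 : ContDiffAt ℝ N (φ.implicitFunction (g a)) 0 := by
    have : ContDiffAt ℝ N (fun y : (fderiv ℝ g a).ker => (g a, y)) 0 := by fun_prop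
    exact hc.comp (0 : (fderiv ℝ g a).ker) this
  have e1 : ∀ᶠ y in 𝓝 (0 : (fderiv ℝ g a).ker), ContDiffAt ℝ N (φ.implicitFunction (g a)) y :=
    hc2.eventually (by simp)
  have e2 : ∀ᶠ y in 𝓝 (0 : (fderiv ℝ g a).ker), g (φ.implicitFunction (g a) y) = g a := by
    have h1 := hs.map_implicitFunctionOfComplemented_eq hr hker
    have h2 : Tendsto (fun y : (fderiv ℝ g a).ker => (g a, y)) (𝓝 0) (𝓝 (g a, 0)) :=
      (by fun_prop : Continuous (fun y : (fderiv ℝ g a).ker => (g a, y))).tendsto 0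
    exact h2.eventually h1
  obtain ⟨W, hW, hWo, hW0⟩ := eventually_nhds_iff.1 (e1.and e2)
  refine ⟨φ.implicitFunction (g a), W, hWo, fun y hy => (hW y hy).1.contDiffWithinAt,
    fun y hy => (hW y hy).2, ?_⟩
  have e3 := φ.implicitFunction_apply_image
  have e4 : ∀ᶠ x in 𝓝 a, φ.rightFun x ∈ W := by
    have : Tendsto φ.rightFun (𝓝 a) (𝓝 (φ.rightFun a)) := hright.continuous.tendsto a
    refine this.eventually (hWo.mem_nhds ?_)
    have h0 : φ.rightFun a = 0 := congrArg Prod.snd hpt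
    rwa [h0]
  refine ⟨_, e3.and e4, fun x hx hgx => ⟨φ.rightFun x, hx.2, ?_⟩⟩
  have := hx.1
  rwa [show φ.leftFun x = g a from hgx] at this

theorem finrank_ker_add_one {l : V →L[ℝ] ℝ} (hl : l ≠ 0) :
    Module.finrank ℝ l.ker + 1 = Module.finrank ℝ V := by
  have h := LinearMap.finrank_range_add_finrank_ker (l : V →ₗ[ℝ] ℝ)
  have hr : (l : V →ₗ[ℝ] ℝ).range = ⊤ := by
    refine LinearMap.range_eq_top.2 (LinearMap.surjective ?_)
    intro h
    exact hl (by ext v; exact DFunLike.congr_fun h v)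
  rw [hr, finrank_top, Module.finrank_self] at h
  have : Module.finrank ℝ l.ker = Module.finrank ℝ (l : V →ₗ[ℝ] ℝ).ker := rfl
  omega

/-- The values at points where all derivatives up to the order of the dimension vanish form a
null set. -/
theorem volume_image_flat_eq_zero {f : V → ℝ} {U : Set V} (hU : IsOpen U)
    (hf : ContDiffOn ℝ (Module.finrank ℝ V + 1 : ℕ) f U) :
    volume (f '' {x ∈ U | ∀ i, 1 ≤ i → i ≤ Module.finrank ℝ V → iteratedFDeriv ℝ i f x = 0}) = 0 := by
  set m := Module.finrank ℝ V
  set S := {x ∈ U | ∀ i, 1 ≤ i → i ≤ m → iteratedFDeriv ℝ i f x = 0}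
  -- On the flat set `f` is locally Hölder with exponent `m + 1`. The image then has dimension at
  -- most `m / (m + 1) < 1`, so its one-dimensional Hausdorff measure, which is Lebesgue measure,
  -- vanishes.
  have h1 : dimH (f '' S) ≤ dimH S / ((m + 1 : ℕ) : ℝ≥0) := by
    refine dimH_image_le_of_locally_holder_on (by positivity) fun x hx => ?_
    obtain ⟨C, hC, O, hO, h⟩ := exists_norm_sub_le_pow (k := m) (hf.contDiffAt (hU.mem_nhds hx.1))
    refine ⟨C.toNNReal, O ∩ S, Filter.inter_mem (mem_nhdsWithin_of_mem_nhds hO)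
      self_mem_nhdsWithin, fun y hy z hz => ?_⟩
    have h' := h z hz.1 y hy.1 hz.2.2
    rw [edist_dist, edist_dist, Real.dist_eq, dist_eq_norm]
    rw [ENNReal.ofReal_rpow_of_nonneg (norm_nonneg _) (by positivity)]
    change _ ≤ ENNReal.ofReal C * _
    rw [← ENNReal.ofReal_mul hC]
    refine ENNReal.ofReal_le_ofReal ?_
    rw [NNReal.coe_natCast, Real.rpow_natCast]
    exact h'
  have h2 : dimH S ≤ m := by
    calc dimH S ≤ dimH (Set.univ : Set V) := dimH_mono (Set.subset_univ _)
      _ = m := Real.dimH_univ_eq_finrank V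
  have h3 : dimH (f '' S) < ((1 : ℝ≥0) : ℝ≥0∞) := by
    refine (h1.trans (ENNReal.div_le_div_right h2 _)).trans_lt ?_
    rw [ENNReal.coe_natCast, ENNReal.coe_one, ENNReal.div_lt_iff (by simp) (by simp), one_mul]
    exact_mod_cast Nat.lt_succ_self m
  have := hausdorffMeasure_of_dimH_lt h3
  rwa [NNReal.coe_one, hausdorffMeasure_real] at this

/-- By second countability, countably many of the relative neighbourhoods already cover `S`. -/
theorem volume_image_eq_zero_of_locally {f : V → ℝ} {S : Set V}
    (h : ∀ x ∈ S, ∃ U ∈ 𝓝[S] x, volume (f '' U) = 0) : volume (f '' S) = 0 := by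
  choose! U hU hU0 using h
  obtain ⟨t, htS, htc, ht⟩ := TopologicalSpace.countable_cover_nhdsWithin hU
  refine measure_mono_null (Set.image_mono ht) ?_
  rw [Set.image_iUnion₂]
  exact (measure_biUnion_null_iff htc).2 fun x hx => hU0 x (htS hx)

/-- **Sard's theorem** for real-valued functions: the critical values of a sufficiently smooth
function on an open subset of an `m`-dimensional space form a null set. -/
theorem exists_sard (m : ℕ) : ∃ N : ℕ, N ≠ 0 ∧ ∀ (V : Type u) [NormedAddCommGroup V] [NormedSpace ℝ V]
    [FiniteDimensional ℝ V], Module.finrank ℝ V = m → ∀ (f : V → ℝ) (U : Set V), IsOpen U →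
    ContDiffOn ℝ N f U → volume (f '' {x ∈ U | fderiv ℝ f x = 0}) = 0 := by
  induction m with
  | zero =>
    refine ⟨1, one_ne_zero, fun V _ _ _ hV f U hU hf => ?_⟩
    have : Subsingleton V := Module.finrank_zero_iff.1 hV
    exact ((Set.subsingleton_of_subsingleton).image f).measure_zero _
  | succ m ih =>
    obtain ⟨N, hN, ih⟩ := ih
    -- This order is convenient rather than sharp. Derivatives of order `j ≤ m + 1` must still be
    -- `C^N` for the induction hypothesis, and flat points in dimension `m + 1` need `m + 2`
    -- derivatives.
    refine ⟨N + (m + 2), by omega, fun V _ _ _ hV f U hU hf => ?_⟩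
    have hfa : ∀ x ∈ U, ContDiffAt ℝ (N + (m + 2) : ℕ) f x := fun x hx =>
      hf.contDiffAt (hU.mem_nhds hx)
    set A : ℕ → Set V := fun j => {x ∈ U | ∀ i, 1 ≤ i → i ≤ j → iteratedFDeriv ℝ i f x = 0}
    -- If the derivatives up to order `j` vanish but the next one does not, some component `g` of
    -- the `j`-th derivative has nonzero differential. The nearby points of `A j` then lie on the
    -- regular hypersurface `g = 0` of dimension `m`. Since `j ≥ 1`, they are critical for `f`
    -- restricted to it, and the induction hypothesis applies.
    have hA : ∀ j, 1 ≤ j → j ≤ m + 1 →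
        volume (f '' {x ∈ A j | iteratedFDeriv ℝ (j + 1) f x ≠ 0}) = 0 := by
      intro j hj1 hjm
      refine volume_image_eq_zero_of_locally fun a ha => ?_
      have haU : a ∈ U := ha.1.1
      have hne : fderiv ℝ (iteratedFDeriv ℝ j f) a ≠ 0 := by
        intro h0
        apply ha.2
        ext w
        rw [iteratedFDeriv_succ_apply_left, h0]
        rfl
      have hj : ContDiffAt ℝ N (iteratedFDeriv ℝ j f) a := by
        refine (hfa a haU).iteratedFDeriv_right (m := (N : ℕ)) ?_
        exact_mod_cast (by omega : N + j ≤ N + (m + 2))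
      obtain ⟨v, hv⟩ : ∃ v : Fin j → V, fderiv ℝ (fun x => iteratedFDeriv ℝ j f x v) a ≠ 0 := by
        by_contra! hcon
        apply hne
        ext w v
        have h1 : HasFDerivAt (iteratedFDeriv ℝ j f) (fderiv ℝ (iteratedFDeriv ℝ j f) a) a :=
          (hj.differentiableAt (by exact_mod_cast hN)).hasFDerivAt
        have h2 := ((ContinuousMultilinearMap.apply ℝ (fun _ : Fin j => V) ℝ v).hasFDerivAt.comp a h1).fderiv
        have h3 := hcon v
        change fderiv ℝ (fun x => iteratedFDeriv ℝ j f x v) a = _ at h2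
        rw [h3] at h2
        have := DFunLike.congr_fun h2.symm w
        simpa using this
      set g : V → ℝ := fun x => iteratedFDeriv ℝ j f x v
      have hg : ContDiffAt ℝ N g a :=
        (ContinuousMultilinearMap.apply ℝ (fun _ : Fin j => V) ℝ v).contDiff.contDiffAt.comp a hj
      obtain ⟨ψ, W, hW, hψ, hgψ, O, hO, hOW⟩ := exists_levelSet_chart hN hg hv
      have hgA : ∀ x ∈ A j, g x = 0 := fun x hx => by
        simp [g, hx.2 j hj1 le_rfl]
      set W' := W ∩ ψ ⁻¹' U
      have hW' : IsOpen W' := hψ.continuousOn.isOpen_inter_preimage hW hU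
      have hcomp : ContDiffOn ℝ N (f ∘ ψ) W' := by
        refine (hf.of_le ?_).comp (hψ.mono Set.inter_subset_left) (fun y hy => hy.2)
        exact_mod_cast (by omega : N ≤ N + (m + 2))
      have hfin : Module.finrank ℝ (fderiv ℝ g a).ker = m := by
        have := finrank_ker_add_one hv
        omega
      have hS := ih (fderiv ℝ g a).ker hfin (f ∘ ψ) W' hW' hcomp
      refine ⟨O ∩ {x ∈ A j | iteratedFDeriv ℝ (j + 1) f x ≠ 0},
        Filter.inter_mem (mem_nhdsWithin_of_mem_nhds hO) self_mem_nhdsWithin,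
        measure_mono_null ?_ hS⟩
      rintro _ ⟨x, ⟨hxO, hxA, -⟩, rfl⟩
      obtain ⟨y, hyW, rfl⟩ := hOW x hxO ((hgA x hxA).trans (hgA a ha.1).symm)
      refine ⟨y, ⟨⟨hyW, hxA.1⟩, ?_⟩, rfl⟩
      have hd : fderiv ℝ f (ψ y) = 0 := by
        rw [← norm_eq_zero, ← norm_iteratedFDeriv_one, hxA.2 1 le_rfl hj1, norm_zero]
      have d1 : DifferentiableAt ℝ f (ψ y) := (hfa _ hxA.1).differentiableAt (by simp)
      have d2 : DifferentiableAt ℝ ψ y :=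
        ((hψ.contDiffAt (hW.mem_nhds hyW)).differentiableAt (by exact_mod_cast hN))
      rw [fderiv_comp y d1 d2, hd, ContinuousLinearMap.zero_comp]
    have hflat : volume (f '' A (m + 1)) = 0 := by
      have := volume_image_flat_eq_zero hU (f := f) (hf.of_le (by rw [hV]; exact_mod_cast (by omega)))
      rwa [hV] at this
    -- At a critical point either all derivatives of orders `1, …, m + 1` vanish, or there is a
    -- first order at which one does not.
    have hsub : f '' {x ∈ U | fderiv ℝ f x = 0} ⊆ f '' A (m + 1) ∪
        ⋃ j ∈ Set.Icc 1 (m + 1), f '' {x ∈ A j | iteratedFDeriv ℝ (j + 1) f x ≠ 0} := by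
      rintro _ ⟨x, ⟨hxU, hx⟩, rfl⟩
      have h1 : x ∈ A 1 := by
        refine ⟨hxU, fun i h1 h2 => ?_⟩
        obtain rfl : i = 1 := le_antisymm h2 h1
        rw [← norm_eq_zero, norm_iteratedFDeriv_one, hx, norm_zero]
      by_contra hcon
      simp only [Set.mem_union, Set.mem_iUnion, not_or, not_exists] at hcon
      have : ∀ j, 1 ≤ j → j ≤ m + 1 → x ∈ A j := by
        intro j hj
        induction j, hj using Nat.le_induction with
        | base => exact fun _ => h1
        | succ j hj ihj =>
          intro hjm
          have hxj := ihj (by omega)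
          refine ⟨hxU, fun i hi1 hi2 => ?_⟩
          rcases hi2.lt_or_eq with h | rfl
          · exact hxj.2 i hi1 (by omega)
          · by_contra hne
            exact hcon.2 j ⟨hj, by omega⟩ ⟨x, ⟨hxj, hne⟩, rfl⟩
      exact hcon.1 ⟨x, this (m + 1) (by omega) le_rfl, rfl⟩
    refine measure_mono_null hsub (measure_union_null hflat ?_)
    exact (measure_biUnion_null_iff (Set.to_countable _)).2 fun j hj => hA j hj.1 hj.2

end Sard

/-! ### Smoothness of the symbol -/

section Symbol

variable {ι : Type} [Fintype ι]

/-- A finite set of multi-indices lies in a box, over which the sum of products factorises. -/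
theorem summable_prod_apply {g : ℤ → ℝ} (hg : Summable g) (h0 : ∀ k, 0 ≤ g k) :
    Summable fun n : ι → ℤ => ∏ i, g (n i) := by
  classical
  refine summable_of_sum_le (c := ∏ _i : ι, ∑' k, g k)
    (fun n => Finset.prod_nonneg fun i _ => h0 _) fun s => ?_
  calc ∑ n ∈ s, ∏ i, g (n i)
      ≤ ∑ n ∈ Fintype.piFinset fun i => s.image fun n => n i, ∏ i, g (n i) := by
        refine Finset.sum_le_sum_of_subset_of_nonneg (fun n hn => ?_)
          fun n _ _ => Finset.prod_nonneg fun i _ => h0 _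
        exact Fintype.mem_piFinset.2 fun i => Finset.mem_image_of_mem _ hn
    _ = ∏ i, ∑ k ∈ s.image fun n => n i, g k := (Finset.prod_univ_sum _ _).symm
    _ ≤ ∏ _i : ι, ∑' k, g k := Finset.prod_le_prod
        (fun i _ => Finset.sum_nonneg fun k _ => h0 k) fun i _ => hg.sum_le_tsum _ fun k _ => h0 k

theorem summable_exp_neg_norm {a : ℝ} (ha : 0 < a) :
    Summable fun n : ι → ℤ => Real.exp (-(a * ‖n‖)) := by
  -- The norm is the maximum norm, so `∑ |n i| ≤ card ι * ‖n‖`. With the rate `b`, a product of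
  -- one-dimensional geometric series dominates. The `+ 1` covers an empty index type.
  set b := a / (Fintype.card ι + 1)
  have hb : 0 < b := by positivity
  have h1 : Summable fun k : ℤ => Real.exp (-(b * |(k : ℝ)|)) := by
    refine Summable.of_nat_of_neg ?_ ?_ <;>
    · simpa [mul_comm] using Real.summable_exp_nat_mul_iff.2 (neg_lt_zero.2 hb)
  refine Summable.of_nonneg_of_le (fun _ => (Real.exp_pos _).le) (fun n => ?_)
    (summable_prod_apply h1 fun _ => (Real.exp_pos _).le)
  rw [← Real.exp_sum, Real.exp_le_exp, Finset.sum_neg_distrib, neg_le_neg_iff, ← Finset.mul_sum]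
  have h2 : ∑ i, |(n i : ℝ)| ≤ Fintype.card ι * ‖n‖ := by
    have := Finset.sum_le_card_nsmul Finset.univ (fun i => |(n i : ℝ)|) ‖n‖ fun i _ => by
      simpa [Int.norm_eq_abs] using norm_le_pi_norm n i
    simpa using this
  calc b * ∑ i, |(n i : ℝ)| ≤ b * ((Fintype.card ι + 1) * ‖n‖) := by
        gcongr
        refine h2.trans ?_
        nlinarith [norm_nonneg n]
    _ = a * ‖n‖ := by simp only [b]; field_simp

theorem ExpDecay.summable_norm {c : (ι → ℤ) → ℂ} (hc : ExpDecay c) : Summable fun n => ‖c n‖ := by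
  obtain ⟨C, a, ha, h⟩ := hc
  exact Summable.of_nonneg_of_le (fun _ => norm_nonneg _) h ((summable_exp_neg_norm ha).mul_left C)

/-- The Fourier coefficients of the partial derivative of the symbol along the coordinate `j`. -/
def diffCoeff (j : ι) (c : (ι → ℤ) → ℂ) (n : ι → ℤ) : ℂ := 2 * Real.pi * Complex.I * n j * c n

/-- Half of the decay rate absorbs the linear factor `n j`. Exponential decay is thus stable under
differentiation, which permits induction on the order of smoothness. -/
theorem ExpDecay.diffCoeff {c : (ι → ℤ) → ℂ} (hc : ExpDecay c) (j : ι) :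
    ExpDecay (diffCoeff j c) := by
  obtain ⟨C, a, ha, h⟩ := hc
  refine ⟨2 * Real.pi * (2 / a) * C, a / 2, by positivity, fun n => ?_⟩
  have h1 : ‖(n j : ℂ)‖ ≤ ‖n‖ := by
    simpa [Int.norm_eq_abs] using norm_le_pi_norm n j
  have h2 : ‖n‖ ≤ 2 / a * Real.exp (a / 2 * ‖n‖) := by
    have := Real.add_one_le_exp (a / 2 * ‖n‖)
    rw [div_mul_eq_mul_div, le_div_iff₀ ha]
    linarith
  have hn : ‖LatticeGreen.diffCoeff j c n‖ = 2 * Real.pi * (‖(n j : ℂ)‖ * ‖c n‖) := by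
    simp only [LatticeGreen.diffCoeff, norm_mul, Complex.norm_I, Complex.norm_real,
      Real.norm_eq_abs, abs_of_pos Real.pi_pos]
    norm_num
    ring
  rw [hn]
  calc 2 * Real.pi * (‖(n j : ℂ)‖ * ‖c n‖)
      ≤ 2 * Real.pi * ((2 / a * Real.exp (a / 2 * ‖n‖)) * (C * Real.exp (-(a * ‖n‖)))) := by
        gcongr
        · exact h1.trans h2
        · exact h n
    _ = 2 * Real.pi * (2 / a) * C * (Real.exp (a / 2 * ‖n‖) * Real.exp (-(a * ‖n‖))) := by ring
    _ = _ := by rw [← Real.exp_add]; congr 2; ring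

theorem mFourier_coe (n : ι → ℤ) (x : ι → ℝ) :
    UnitAddTorus.mFourier n (fun i => (x i : UnitAddCircle)) =
      Complex.exp (∑ i, 2 * Real.pi * Complex.I * n i * x i) := by
  rw [Complex.exp_sum]
  refine Finset.prod_congr rfl fun i _ => ?_
  rw [fourier_coe_apply]
  simp

/-- The symbol series as a continuous complex function on the torus. -/
def symbolC (c : (ι → ℤ) → ℂ) : C(UnitAddTorus ι, ℂ) := ∑' n, c n • UnitAddTorus.mFourier n

theorem ExpDecay.summable_symbolC {c : (ι → ℤ) → ℂ} (hc : ExpDecay c) :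
    Summable fun n => c n • UnitAddTorus.mFourier n :=
  Summable.of_norm (by simpa [norm_smul, UnitAddTorus.mFourier_norm] using hc.summable_norm)

theorem ExpDecay.symbolC_apply {c : (ι → ℤ) → ℂ} (hc : ExpDecay c) (x : UnitAddTorus ι) :
    symbolC c x = ∑' n, c n * UnitAddTorus.mFourier n x :=
  ((ContinuousMap.evalCLM ℂ x).map_tsum hc.summable_symbolC)

theorem ExpDecay.symbol_eq_re {c : (ι → ℤ) → ℂ} (hc : ExpDecay c) (x : UnitAddTorus ι) :
    symbol c x = (symbolC c x).re := by rw [hc.symbolC_apply]; rfl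

theorem ExpDecay.continuous_symbol {c : (ι → ℤ) → ℂ} (hc : ExpDecay c) :
    Continuous (symbol c) := by
  simp_rw [funext hc.symbol_eq_re]
  fun_prop

theorem symbolC_eq_ofReal {c : (ι → ℤ) → ℂ} (hc : ExpDecay c) (hh : HermitianCoeff c)
    (x : UnitAddTorus ι) : symbolC c x = symbol c x := by
  rw [hc.symbol_eq_re]
  refine (Complex.conj_eq_iff_re.1 ?_).symm
  rw [hc.symbolC_apply, Complex.conj_tsum]
  rw [← (Equiv.neg (ι → ℤ)).tsum_eq]
  refine tsum_congr fun n => ?_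
  rw [map_mul, Equiv.neg_apply, ← UnitAddTorus.mFourier_neg, neg_neg, ← hh]

theorem ExpDecay.hasFDerivAt_symbolC {c : (ι → ℤ) → ℂ} (hc : ExpDecay c) (x : ι → ℝ) :
    HasFDerivAt (fun y : ι → ℝ => symbolC c (fun i => (y i : UnitAddCircle)))
      (∑ j, symbolC (LatticeGreen.diffCoeff j c) (fun i => (x i : UnitAddCircle)) •
        (Complex.ofRealCLM ∘L ContinuousLinearMap.proj (R := ℝ) (φ := fun _ : ι => ℝ) j)) x := by
  set L : ι → (ι → ℝ) →L[ℝ] ℂ := fun j =>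
    Complex.ofRealCLM ∘L ContinuousLinearMap.proj (R := ℝ) (φ := fun _ : ι => ℝ) j
  have hL : ∀ j, ‖L j‖ ≤ 1 := fun j => by
    refine ContinuousLinearMap.opNorm_le_bound _ zero_le_one fun y => ?_
    simpa [L] using norm_le_pi_norm y j
  set e : (ι → ℤ) → (ι → ℝ) → ℂ := fun n y =>
    UnitAddTorus.mFourier n (fun i => (y i : UnitAddCircle))
  have he : ∀ n y, ‖e n y‖ ≤ 1 := fun n y =>
    ((UnitAddTorus.mFourier n).norm_coe_le_norm _).trans UnitAddTorus.mFourier_norm.le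
  have hed : ∀ n y, HasFDerivAt (e n) (∑ j, (2 * Real.pi * Complex.I * n j * e n y) • L j) y := by
    intro n y
    have h1 : HasFDerivAt (fun y : ι → ℝ => ∑ i, 2 * Real.pi * Complex.I * n i * (y i : ℂ))
        (∑ j, (2 * Real.pi * Complex.I * n j) • L j) y :=
      HasFDerivAt.fun_sum fun j _ => ((L j).hasFDerivAt).const_mul _
    have h2 := h1.cexp
    have h3 : e n = fun y => Complex.exp (∑ i, 2 * Real.pi * Complex.I * n i * (y i : ℂ)) :=
      funext fun y => mFourier_coe n y
    rw [h3]
    convert! h2 using 1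
    rw [Finset.smul_sum]
    refine Finset.sum_congr rfl fun j _ => ?_
    rw [smul_smul, mul_comm]
  set u : (ι → ℤ) → ℝ := fun n => ∑ j, ‖LatticeGreen.diffCoeff j c n‖
  have hu : Summable u := summable_sum fun j _ => (hc.diffCoeff j).summable_norm
  have hsum : ∀ j, Summable fun n => LatticeGreen.diffCoeff j c n * e n x := fun j =>
    Summable.of_norm_bounded (hc.diffCoeff j).summable_norm fun n => by
      rw [norm_mul]; exact mul_le_of_le_one_right (norm_nonneg _) (he n x)
  have key := hasFDerivAt_tsum (𝕜 := ℝ) (f := fun n y => c n * e n y)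
    (f' := fun n y => ∑ j, (LatticeGreen.diffCoeff j c n * e n y) • L j) (x₀ := x) hu ?_ ?_ ?_ x
  · convert! key using 1
    · exact funext fun y => hc.symbolC_apply _
    · rw [Summable.tsum_finsetSum fun j _ => (hsum j).smul_const _]
      refine Finset.sum_congr rfl fun j _ => ?_
      rw [(hc.diffCoeff j).symbolC_apply, (hsum j).tsum_smul_const]
  · intro n y
    convert! (hed n y).const_mul (c n) using 1
    rw [Finset.smul_sum]
    refine Finset.sum_congr rfl fun j _ => ?_
    rw [smul_smul, LatticeGreen.diffCoeff]
    congr 1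
    ring
  · intro n y
    refine (norm_sum_le _ _).trans (Finset.sum_le_sum fun j _ => ?_)
    rw [norm_smul, norm_mul]
    calc _ ≤ ‖LatticeGreen.diffCoeff j c n‖ * 1 * 1 := by gcongr; exacts [he n y, hL j]
      _ = _ := by ring
  · exact Summable.of_norm_bounded hc.summable_norm fun n => by
      rw [norm_mul]; exact mul_le_of_le_one_right (norm_nonneg _) (he n x)

theorem ExpDecay.hasFDerivAt_symbolLift {c : (ι → ℤ) → ℂ} (hc : ExpDecay c) (x : ι → ℝ) :
    HasFDerivAt (symbolLift c) (∑ j, symbolLift (LatticeGreen.diffCoeff j c) x •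
      ContinuousLinearMap.proj (R := ℝ) (φ := fun _ : ι => ℝ) j) x := by
  have h := Complex.reCLM.hasFDerivAt.comp x (hc.hasFDerivAt_symbolC x)
  convert! h using 1
  · exact funext fun y => hc.symbol_eq_re _
  · ext v
    simp [symbolLift, (hc.diffCoeff _).symbol_eq_re]

theorem ExpDecay.fderiv_symbolLift {c : (ι → ℤ) → ℂ} (hc : ExpDecay c) (x v : ι → ℝ) :
    fderiv ℝ (symbolLift c) x v = ∑ j, symbolLift (LatticeGreen.diffCoeff j c) x * v j := by
  rw [(hc.hasFDerivAt_symbolLift x).fderiv]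
  simp

/-- The partial derivatives are again symbols with exponentially decaying coefficients, so the
induction runs over all such coefficients at once. -/
theorem ExpDecay.contDiff_symbolLift {c : (ι → ℤ) → ℂ} (hc : ExpDecay c) (N : ℕ) :
    ContDiff ℝ N (symbolLift c) := by
  induction N generalizing c with
  | zero =>
    exact contDiff_zero.2 (continuous_iff_continuousAt.2 fun x =>
      (hc.hasFDerivAt_symbolLift x).continuousAt)
  | succ N ih =>
    rw [Nat.cast_succ]
    refine (contDiff_succ_iff_hasFDerivAt).2 ⟨_, ?_, hc.hasFDerivAt_symbolLift⟩
    exact ContDiff.sum fun j _ => (ih (hc.diffCoeff j)).smul contDiff_const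

theorem exists_lift {κ : Type} (x : UnitAddTorus κ) : ∃ y : κ → ℝ, (fun i => (y i : UnitAddCircle)) = x := by
  choose y hy using fun i => QuotientAddGroup.mk_surjective (x i)
  exact ⟨y, funext hy⟩

theorem ExpDecay.hasDerivAt_symbol [DecidableEq ι] {c : (ι → ℤ) → ℂ} (hc : ExpDecay c)
    (x : UnitAddTorus ι) (j : ι) :
    HasDerivAt (fun t : ℝ => symbol c (x + Pi.single j (t : UnitAddCircle)))
      (symbol (LatticeGreen.diffCoeff j c) x) 0 := by
  obtain ⟨y, rfl⟩ := exists_lift x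
  have hl : HasDerivAt (fun t : ℝ => y + t • Pi.single j (1 : ℝ)) (Pi.single j (1 : ℝ)) 0 := by
    simpa using ((hasDerivAt_id (0 : ℝ)).smul_const (Pi.single j (1 : ℝ) : ι → ℝ)).const_add y
  have h := (show HasFDerivAt (symbolLift c) _ (y + (0 : ℝ) • Pi.single j (1 : ℝ)) from
    hc.hasFDerivAt_symbolLift _).comp_hasDerivAt (0 : ℝ) hl
  convert! h using 1
  · funext t
    simp only [Function.comp, symbolLift]
    congr 1
    funext i
    by_cases hi : i = j
    · subst hi; simp
    · simp [hi]
  · simp [symbolLift, Pi.single_apply]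

end Symbol

/-! ### Critical fibres -/

section CriticalFibres

/-- The set is the image of a compact set under the projection. This supplies measurability of the
exceptional sets of fibres and of `Σ_{E,1}`. -/
theorem isClosed_setOf_exists_elim {ι κ : Type} {K : Set (UnitAddTorus (ι ⊕ κ))}
    (hK : IsClosed K) : IsClosed {x₁ : UnitAddTorus ι | ∃ x₂, Sum.elim x₁ x₂ ∈ K} := by
  have h : {x₁ : UnitAddTorus ι | ∃ x₂, Sum.elim x₁ x₂ ∈ K} = (fun x i => x (Sum.inl i)) '' K := by
    ext x₁
    constructor
    · rintro ⟨x₂, h⟩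
      exact ⟨_, h, rfl⟩
    · rintro ⟨x, h, rfl⟩
      exact ⟨fun j => x (Sum.inr j), by
        rwa [show Sum.elim (fun i => x (Sum.inl i)) (fun j => x (Sum.inr j)) = x from
          Sum.elim_comp_inl_inr x]⟩
  rw [h]
  exact (hK.isCompact.image (by fun_prop)).isClosed

/-- A closed subset of the torus is null if its periodic lift is null. -/
theorem torusMeasure_eq_zero_of_lift {ι : Type} [Fintype ι] {S : Set (UnitAddTorus ι)}
    (hS : MeasurableSet S)
    (h : volume ((fun (y : ι → ℝ) i => (y i : UnitAddCircle)) ⁻¹' S) = 0) :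
    torusMeasure ι S = 0 := by
  have h1 : MeasurePreserving (fun y : ℝ => (y : UnitAddCircle))
      (volume.restrict (Set.Ioc 0 1)) AddCircle.haarAddCircle := by
    have := UnitAddCircle.measurePreserving_mk 0
    rw [zero_add, AddCircle.volume_eq_smul_haarAddCircle] at this
    simpa using this
  have h2 := measurePreserving_pi (fun _ : ι => volume.restrict (Set.Ioc (0 : ℝ) 1))
    (fun _ => AddCircle.haarAddCircle) (fun _ => h1)
  rw [torusMeasure, ← h2.measure_preimage hS.nullMeasurableSet, ← Measure.restrict_pi_pi]
  exact le_antisymm ((Measure.restrict_apply_le _ _).trans h.le) bot_le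

variable {ι κ : Type} [Fintype ι] [Fintype κ] [DecidableEq ι]

/-- Sard's theorem for the coordinate `t` on the hypersurface `F(t, w) = E`. Where the
`w`-derivatives of `F` vanish and the `t`-derivative does not, `dF` is a nonzero multiple of `dt`.
So `dt` vanishes on the tangent space, and `t` is a critical value. -/
theorem volume_critical_line {c : (ι ⊕ κ → ℤ) → ℂ} (hc : ExpDecay c) (E : ℝ) (y : ι → ℝ) (i : ι) :
    volume {t : ℝ | ∃ w : κ → ℝ,
      symbolLift c (Sum.elim (y + Pi.single i t) w) = E ∧
      (∀ j, symbolLift (diffCoeff (Sum.inr j) c) (Sum.elim (y + Pi.single i t) w) = 0) ∧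
      symbolLift (diffCoeff (Sum.inl i) c) (Sum.elim (y + Pi.single i t) w) ≠ 0} = 0 := by
  set P : ℝ × (κ → ℝ) → (ι ⊕ κ → ℝ) := fun p => Sum.elim (y + Pi.single i p.1) p.2
  have hP : ∀ N : ℕ, ContDiff ℝ N P := by
    intro N
    refine contDiff_pi.2 fun k => ?_
    rcases k with k | k
    · by_cases hk : k = i
      · subst hk
        simpa [P] using contDiff_const.add contDiff_fst
      · simpa [P, hk] using contDiff_const
    · simp only [P, Sum.elim_inr]
      fun_prop
  set F : ℝ × (κ → ℝ) → ℝ := fun p => symbolLift c (P p)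
  have hF : ∀ N : ℕ, ContDiff ℝ N F := fun N => (hc.contDiff_symbolLift N).comp (hP N)
  have hPd : ∀ p v : ℝ × (κ → ℝ), fderiv ℝ P p v = Sum.elim (Pi.single i v.1) v.2 := by
    intro p v
    have h1 : HasDerivAt (fun s : ℝ => P (p + s • v)) (Sum.elim (Pi.single i v.1) v.2) 0 := by
      refine hasDerivAt_pi.2 fun k => ?_
      rcases k with k | k
      · by_cases hk : k = i
        · subst hk
          have := ((hasDerivAt_id (0 : ℝ)).mul_const v.1).const_add (y k + p.1)
          simpa [P, add_assoc] using this
        · simpa [P, hk] using hasDerivAt_const (0 : ℝ) (y k)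
      · have := ((hasDerivAt_id (0 : ℝ)).mul_const (v.2 k)).const_add (p.2 k)
        simpa [P] using this
    have h2 : HasDerivAt (fun s : ℝ => p + s • v) v 0 := by
      simpa using ((hasDerivAt_id (0 : ℝ)).smul_const v).const_add p
    have h3 := (show HasFDerivAt P (fderiv ℝ P (p + (0 : ℝ) • v)) (p + (0 : ℝ) • v) from
      ((hP 1).differentiable (by simp) _).hasFDerivAt).comp_hasDerivAt (0 : ℝ) h2
    rw [zero_smul, add_zero] at h3
    exact h3.unique h1
  have hFd : ∀ p v : ℝ × (κ → ℝ), fderiv ℝ F p v =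
      symbolLift (diffCoeff (Sum.inl i) c) (P p) * v.1 +
        ∑ j, symbolLift (diffCoeff (Sum.inr j) c) (P p) * v.2 j := by
    intro p v
    have := fderiv_comp p ((hc.contDiff_symbolLift 1).differentiable (by simp) (P p))
      ((hP 1).differentiable (by simp) p)
    change fderiv ℝ (symbolLift c ∘ P) p v = _
    rw [this, ContinuousLinearMap.comp_apply, hPd, hc.fderiv_symbolLift, Fintype.sum_sum_type]
    simp [Pi.single_apply]
  set S : Set (ℝ × (κ → ℝ)) := {p | F p = E ∧
    (∀ j, symbolLift (diffCoeff (Sum.inr j) c) (P p) = 0) ∧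
    symbolLift (diffCoeff (Sum.inl i) c) (P p) ≠ 0}
  have hS : volume (Prod.fst '' S) = 0 := by
    refine volume_image_eq_zero_of_locally fun a ha => ?_
    have hne : fderiv ℝ F a ≠ 0 := by
      intro h
      have := hFd a (1, 0)
      rw [h] at this
      exact ha.2.2 (by simpa using this.symm)
    obtain ⟨N, hN, hsard⟩ := exists_sard.{0} (Module.finrank ℝ (fderiv ℝ F a).ker)
    obtain ⟨ψ, W, hW, hψ, hgψ, O, hO, hOW⟩ := exists_levelSet_chart hN (hF N).contDiffAt hne
    have h0 := hsard (fderiv ℝ F a).ker rfl (Prod.fst ∘ ψ) W hW (contDiff_fst.comp_contDiffOn hψ)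
    refine ⟨O ∩ S, Filter.inter_mem (mem_nhdsWithin_of_mem_nhds hO) self_mem_nhdsWithin,
      measure_mono_null ?_ h0⟩
    rintro _ ⟨x, ⟨hxO, hxS⟩, rfl⟩
    obtain ⟨w, hwW, rfl⟩ := hOW x hxO (hxS.1.trans ha.1.symm)
    refine ⟨w, ⟨hwW, ?_⟩, rfl⟩
    have hψd : HasFDerivAt ψ (fderiv ℝ ψ w) w :=
      ((hψ.contDiffAt (hW.mem_nhds hwW)).differentiableAt (by exact_mod_cast hN)).hasFDerivAt
    have hFd' : HasFDerivAt F (fderiv ℝ F (ψ w)) (ψ w) :=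
      ((hF 1).differentiable (by simp) _).hasFDerivAt
    have h1 := hFd'.comp w hψd
    -- `F` is constant along the chart `ψ`, so the differential of `F` annihilates the image of the
    -- differential of `ψ`.
    have h2 : HasFDerivAt (F ∘ ψ) (0 : (fderiv ℝ F a).ker →L[ℝ] ℝ) w := by
      refine (hasFDerivAt_const (F a) w).congr_of_eventuallyEq ?_
      filter_upwards [hW.mem_nhds hwW] with z hz using hgψ z hz
    have h3 := h1.unique h2
    have h4 := (hasFDerivAt_fst (𝕜 := ℝ) (p := ψ w)).comp w hψd
    rw [h4.fderiv]
    ext v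
    have h5 := DFunLike.congr_fun h3 v
    rw [ContinuousLinearMap.comp_apply, hFd] at h5
    simp only [hxS.2.1, zero_mul, Finset.sum_const_zero, add_zero, zero_apply, mul_eq_zero,
      hxS.2.2, false_or] at h5
    simpa using h5
  refine measure_mono_null ?_ hS
  rintro t ⟨w, h1, h2, h3⟩
  exact ⟨(t, w), ⟨h1, h2, h3⟩, rfl⟩

omit [DecidableEq ι] in
/-- For almost every `x₁`, the level `E` is not critical for the symbol on the fibre over `x₁`. -/
theorem torusMeasure_criticalFibres {c : (ι ⊕ κ → ℤ) → ℂ} (hc : ExpDecay c) {E : ℝ}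
    (hE : NonCritical c E) :
    torusMeasure ι {x₁ | ∃ x₂ : UnitAddTorus κ, symbol c (Sum.elim x₁ x₂) = E ∧
      ∀ j, symbol (diffCoeff (Sum.inr j) c) (Sum.elim x₁ x₂) = 0} = 0 := by
  classical
  -- A quantitative lower bound replaces `≠ 0` so that each piece is closed, hence measurable.
  set B : ι → ℕ → Set (UnitAddTorus ι) := fun i n => {x₁ | ∃ x₂ : UnitAddTorus κ,
    Sum.elim x₁ x₂ ∈ {x | symbol c x = E ∧ (∀ j, symbol (diffCoeff (Sum.inr j) c) x = 0) ∧
      1 / ((n : ℝ) + 1) ≤ |symbol (diffCoeff (Sum.inl i) c) x|}}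
  have hsymm : ∀ j, Continuous (symbol (diffCoeff j c)) := fun j => (hc.diffCoeff j).continuous_symbol
  have hBc : ∀ i n, IsClosed (B i n) := fun i n => by
    refine isClosed_setOf_exists_elim ?_
    simp only [Set.ofPred_and, Set.ofPred_forall]
    refine (isClosed_eq hc.continuous_symbol continuous_const).inter
      ((isClosed_iInter fun j => isClosed_eq (hsymm _) continuous_const).inter
        (isClosed_le continuous_const (hsymm _).abs))
  have hB : ∀ i n, torusMeasure ι (B i n) = 0 := by
    intro i n
    refine torusMeasure_eq_zero_of_lift (hBc i n).measurableSet ?_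
    set q : (ι → ℝ) → UnitAddTorus ι := fun y i => (y i : UnitAddCircle)
    have hq : Continuous q := by fun_prop
    have hmeas : MeasurableSet (q ⁻¹' B i n)ᶜ := ((hBc i n).preimage hq).measurableSet.compl
    -- Fubini: a measurable set that is null on every line parallel to the `i`-th axis is null.
    have := ae_mem_of_ae_add_linearMap_mem (LinearMap.single ℝ (fun _ : ι => ℝ) i) volume volume
      hmeas fun y => ?_
    · have h := mem_ae_iff.1 (show (q ⁻¹' B i n)ᶜ ∈ ae volume from this)
      rwa [compl_compl] at h
    · rw [ae_iff]
      refine measure_mono_null ?_ (volume_critical_line hc E y i)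
      rintro t ht
      obtain ⟨x₂, h1, h2, h3⟩ := not_not.1 ht
      obtain ⟨w, rfl⟩ := exists_lift x₂
      have hlift : (Sum.elim (q (y + LinearMap.single ℝ (fun _ : ι => ℝ) i t))
          (fun j => (w j : UnitAddCircle)) : UnitAddTorus (ι ⊕ κ)) =
          fun k => ((Sum.elim (y + Pi.single i t) w : ι ⊕ κ → ℝ) k : UnitAddCircle) := by
        funext k
        rcases k with k | k <;> rfl
      rw [hlift] at h1 h3
      refine ⟨w, h1, fun j => ?_, ?_⟩
      · have := h2 j
        rw [hlift] at this
        exact this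
      · intro h0
        have h4 : symbol (diffCoeff (Sum.inl i) c) (fun k =>
          ((Sum.elim (y + Pi.single i t) w : ι ⊕ κ → ℝ) k : UnitAddCircle)) = 0 := h0
        rw [h4, abs_zero] at h3
        exact absurd h3 (not_le.2 (by positivity))
  refine measure_mono_null ?_ (measure_iUnion_null fun i => measure_iUnion_null fun n => hB i n)
  rintro x₁ ⟨x₂, h1, h2⟩
  obtain ⟨y, hy⟩ := exists_lift (Sum.elim x₁ x₂ : UnitAddTorus (ι ⊕ κ))
  have hne := hE y (by rw [symbolLift, hy]; exact h1)
  -- The full gradient is nonzero and its fibre components vanish, so some component along the first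
  -- coordinates survives.
  obtain ⟨i, hi⟩ : ∃ i, symbol (diffCoeff (Sum.inl i) c) (Sum.elim x₁ x₂) ≠ 0 := by
    by_contra! hcon
    apply hne
    ext v
    rw [hc.fderiv_symbolLift]
    refine Finset.sum_eq_zero fun k _ => ?_
    rw [symbolLift, hy]
    rcases k with k | k
    · rw [hcon, zero_mul]
    · rw [h2, zero_mul]
  obtain ⟨n, hn⟩ := exists_nat_one_div_lt (abs_pos.2 hi)
  exact Set.mem_iUnion.2 ⟨i, Set.mem_iUnion.2 ⟨n, x₂, h1, h2, hn.le⟩⟩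

end CriticalFibres

/-! ### Integration along lines of the torus -/

section TorusLines

variable {κ : Type} [DecidableEq κ]

/-- Translation along the line moves the parameter `s` to `0`, so derivatives at `0` from every base
point determine all derivatives. -/
theorem hasDerivAt_line {F : Type*} [NormedAddCommGroup F] [NormedSpace ℝ F]
    {v v' : UnitAddTorus κ → F} {j : κ}
    (hv : ∀ x, HasDerivAt (fun t : ℝ => v (x + Pi.single j (t : UnitAddCircle))) (v' x) 0)
    (x : UnitAddTorus κ) (s : ℝ) :
    HasDerivAt (fun t : ℝ => v (x + Pi.single j (t : UnitAddCircle)))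
      (v' (x + Pi.single j (s : UnitAddCircle))) s := by
  have h := hv (x + Pi.single j (s : UnitAddCircle))
  have h2 := HasDerivAt.comp_sub_const s s (by simpa using h)
  convert! h2 using 1
  funext t
  rw [add_assoc, ← Pi.single_add]
  congr 3
  rw [← AddCircle.coe_add, add_sub_cancel]

theorem continuous_line (j : κ) :
    Continuous fun p : UnitAddTorus κ × ℝ => p.1 + Pi.single j (p.2 : UnitAddCircle) := by
  have h : Continuous fun p : UnitAddTorus κ × ℝ =>
      (Pi.single j (p.2 : UnitAddCircle) : UnitAddTorus κ) :=
    (continuous_single j).comp ((AddCircle.continuous_mk' 1).comp continuous_snd)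
  exact continuous_fst.add h

variable [Fintype κ]

/-- Fubini and the translation invariance of Haar measure. -/
theorem integral_line_average {F : Type*} [NormedAddCommGroup F] [NormedSpace ℝ F]
    [CompleteSpace F] {u : UnitAddTorus κ → F} (hu : Continuous u) (j : κ) {a b : ℝ} (hab : a ≤ b) :
    ∫ x, (∫ t in a..b, u (x + Pi.single j (t : UnitAddCircle))) ∂torusMeasure κ =
      (b - a) • ∫ x, u x ∂torusMeasure κ := by
  simp_rw [intervalIntegral.integral_of_le hab]
  have hint : Integrable (Function.uncurry fun (x : UnitAddTorus κ) (t : ℝ) =>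
      u (x + Pi.single j (t : UnitAddCircle)))
      ((torusMeasure κ).prod (volume.restrict (Set.Ioc a b))) := by
    obtain ⟨C, hC⟩ := (isCompact_range hu).isBounded.exists_norm_le
    refine Integrable.of_bound (C := C) ?_ (ae_of_all _ fun p => hC _ ⟨_, rfl⟩)
    exact (hu.comp (continuous_line j)).aestronglyMeasurable
  rw [integral_integral_swap hint]
  have : ∀ t : ℝ, ∫ x, u (x + Pi.single j (t : UnitAddCircle)) ∂torusMeasure κ =
      ∫ x, u x ∂torusMeasure κ := fun t => integral_add_right_eq_self u _
  simp [this, hab]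

/-- The integral over the torus of a partial derivative vanishes. -/
theorem integral_deriv_line_eq_zero {F : Type*} [NormedAddCommGroup F] [NormedSpace ℝ F]
    [CompleteSpace F] {v v' : UnitAddTorus κ → F} {j : κ} (hv' : Continuous v')
    (hv : ∀ x, HasDerivAt (fun t : ℝ => v (x + Pi.single j (t : UnitAddCircle))) (v' x) 0) :
    ∫ x, v' x ∂torusMeasure κ = 0 := by
  have h := integral_line_average hv' j zero_le_one
  rw [sub_zero, one_smul] at h
  rw [← h]
  refine integral_eq_zero_of_ae (ae_of_all _ fun x => ?_)
  have h1 : ∫ t in (0 : ℝ)..1, v' (x + Pi.single j (t : UnitAddCircle)) =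
      v (x + Pi.single j ((1 : ℝ) : UnitAddCircle)) -
        v (x + Pi.single j ((0 : ℝ) : UnitAddCircle)) := by
    refine intervalIntegral.integral_eq_sub_of_hasDerivAt (fun t _ => hasDerivAt_line hv x t) ?_
    exact ((hv'.comp (continuous_line j)).comp (Continuous.prodMk_right x)).intervalIntegrable _ _
  have h2 : ((1 : ℝ) : UnitAddCircle) = 0 := AddCircle.coe_period 1
  simp only [h1, h2, AddCircle.coe_zero, sub_self, Pi.zero_apply]

/-- The Poisson averages of the level sets near a regular zero are bounded below. -/
theorem exists_le_integral_poisson {v v' : UnitAddTorus κ → ℝ} {j : κ} (hvc : Continuous v)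
    (hv' : Continuous v')
    (hv : ∀ x, HasDerivAt (fun t : ℝ => v (x + Pi.single j (t : UnitAddCircle))) (v' x) 0)
    {x₀ : UnitAddTorus κ} (h0 : v x₀ = 0) (h0' : v' x₀ ≠ 0) :
    ∃ δ > 0, ∀ᶠ ε in 𝓝[>] (0 : ℝ), δ ≤ ∫ x, ε / (v x ^ 2 + ε ^ 2) ∂torusMeasure κ := by
  -- The integrand depends on `v ^ 2` only, so `v` may be replaced by `-v`.
  wlog hpos : 0 < v' x₀ generalizing v v'
  · have := this (v := fun x => -v x) (v' := fun x => -v' x) hvc.neg hv'.neg (fun x => (hv x).neg)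
      (by simp [h0]) (by simpa using h0') (by
        rw [Left.neg_pos_iff]; exact lt_of_le_of_ne (not_lt.1 hpos) h0')
    simpa using this
  set τ : UnitAddTorus κ → ℝ → UnitAddTorus κ := fun x t => x + Pi.single j (t : UnitAddCircle)
  have hτ0 : ∀ x, τ x 0 = x := fun x => by simp [τ]
  have hτ : Continuous fun p : UnitAddTorus κ × ℝ => τ p.1 p.2 := continuous_line j
  obtain ⟨K, hK⟩ := (isCompact_range hv').isBounded.exists_norm_le
  have hK' : ∀ x, v' x ≤ K := fun x => (le_abs_self _).trans (hK _ ⟨x, rfl⟩)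
  have hK0 : 0 < K := hpos.trans_le (hK' x₀)
  have hev : ∀ᶠ p : UnitAddTorus κ × ℝ in 𝓝 x₀ ×ˢ 𝓝 0, 0 < v' (τ p.1 p.2) := by
    rw [← nhds_prod_eq]
    refine (hv'.comp hτ).continuousAt.eventually_const_lt ?_
    simpa [hτ0] using hpos
  obtain ⟨pU, hpU, pt, hpt, hUt⟩ := eventually_prod_iff.1 hev
  obtain ⟨r, hr, hball⟩ := Metric.eventually_nhds_iff.1 hpt
  set s := r / 2
  have hs : 0 < s := by positivity
  have hts : ∀ t ∈ Set.Icc (-s) s, pt t := fun t ht => hball (by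
    rw [Real.dist_eq, sub_zero]
    exact (abs_le.2 ht).trans_lt (half_lt_self hr))
  have hmono : StrictMonoOn (fun t => v (τ x₀ t)) (Set.Icc (-s) s) := by
    refine strictMonoOn_of_hasDerivWithinAt_pos (f' := fun t => v' (τ x₀ t)) (convex_Icc _ _)
      (hvc.comp (hτ.comp (Continuous.prodMk_right x₀))).continuousOn
      (fun t _ => (hasDerivAt_line hv x₀ t).hasDerivWithinAt) fun t ht => ?_
    exact hUt hpU.self_of_nhds (hts t (interior_subset ht))
  have h1 : 0 < v (τ x₀ s) := by
    have := hmono ⟨by linarith, hs.le⟩ (Set.right_mem_Icc.2 (by linarith)) hs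
    simpa [hτ0, h0] using this
  have h2 : v (τ x₀ (-s)) < 0 := by
    have := hmono (Set.left_mem_Icc.2 (by linarith)) ⟨by linarith, hs.le⟩ (neg_lt_zero.2 hs)
    simpa [hτ0, h0] using this
  obtain ⟨η, hη, hη1, hη2⟩ : ∃ η > 0, η < v (τ x₀ s) ∧ η < -v (τ x₀ (-s)) := by
    obtain ⟨η, hη, hlt⟩ := exists_between (lt_min h1 (neg_pos.2 h2))
    exact ⟨η, hη, hlt.trans_le (min_le_left _ _), hlt.trans_le (min_le_right _ _)⟩
  have e1 : ∀ᶠ x in 𝓝 x₀, η < v (τ x s) :=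
    (hvc.comp (hτ.comp (Continuous.prodMk_left s))).continuousAt.eventually_const_lt hη1
  have e2 : ∀ᶠ x in 𝓝 x₀, η < -v (τ x (-s)) :=
    (hvc.comp (hτ.comp (Continuous.prodMk_left (-s)))).neg.continuousAt.eventually_const_lt hη2
  obtain ⟨U, hU, hUo, hxU⟩ := eventually_nhds_iff.1 (hpU.and (e1.and e2))
  have hμU : 0 < (torusMeasure κ).real U :=
    ENNReal.toReal_pos (hUo.measure_pos _ ⟨x₀, hxU⟩).ne' (measure_ne_top _ _)
  -- On a line through `U` the function `v` runs from below `-ε` to above `ε`. This contributes at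
  -- least `2 arctan 1` to the integral of `u v'`, hence at least `K⁻¹` times that to the integral
  -- of `u`. Averaging over segments of length `2 s` with base points in `U` gives the constant.
  refine ⟨(2 * s)⁻¹ * ((torusMeasure κ).real U * (K⁻¹ * (2 * Real.arctan 1))), ?_, ?_⟩
  · have : 0 < Real.arctan 1 := by rw [Real.arctan_one]; positivity
    positivity
  filter_upwards [Ioc_mem_nhdsGT hη] with ε hε
  have hε0 : 0 < ε := hε.1
  have hden : ∀ y : ℝ, 0 < y ^ 2 + ε ^ 2 := fun y => by positivity
  set u : UnitAddTorus κ → ℝ := fun x => ε / (v x ^ 2 + ε ^ 2)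
  have hu : Continuous u := continuous_const.div (by fun_prop) fun x => (hden _).ne'
  have hu0 : ∀ x, 0 ≤ u x := fun x => div_nonneg hε0.le (hden _).le
  have hav := integral_line_average hu j (show -s ≤ s by linarith)
  have hcont : ∀ x, Continuous fun t => u (τ x t) := fun x =>
    hu.comp (hτ.comp (Continuous.prodMk_right x))
  have hcont' : ∀ x, Continuous fun t => v' (τ x t) := fun x =>
    hv'.comp (hτ.comp (Continuous.prodMk_right x))
  have hI0 : ∀ x, 0 ≤ ∫ t in -s..s, u (τ x t) := fun x =>
    intervalIntegral.integral_nonneg (by linarith) fun t _ => hu0 _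
  have hlow : ∀ x ∈ U, K⁻¹ * (2 * Real.arctan 1) ≤ ∫ t in -s..s, u (τ x t) := by
    intro x hx
    obtain ⟨hxp, hx1, hx2⟩ := hU x hx
    -- The Poisson kernel times `v'` is the derivative of `arctan (v / ε)`.
    have hd : ∀ t, HasDerivAt (fun t => Real.arctan (v (τ x t) / ε)) (u (τ x t) * v' (τ x t)) t := by
      intro t
      have := ((hasDerivAt_line hv x t).div_const ε).arctan
      convert! this using 1
      simp only [u, τ]
      have := (hden (v (τ x t))).ne'
      have h4 : 1 + (v (τ x t) / ε) ^ 2 = (v (τ x t) ^ 2 + ε ^ 2) / ε ^ 2 := by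
        field_simp; ring
      simp only [τ] at h4 this
      rw [h4]
      field_simp
    have hftc : ∫ t in -s..s, u (τ x t) * v' (τ x t) =
        Real.arctan (v (τ x s) / ε) - Real.arctan (v (τ x (-s)) / ε) :=
      intervalIntegral.integral_eq_sub_of_hasDerivAt (fun t _ => hd t)
        (((hcont x).mul (hcont' x)).intervalIntegrable _ _)
    have hle : ∫ t in -s..s, u (τ x t) * v' (τ x t) ≤ ∫ t in -s..s, u (τ x t) * K :=
      intervalIntegral.integral_mono_on (by linarith)
        (((hcont x).mul (hcont' x)).intervalIntegrable _ _)
        (((hcont x).mul continuous_const).intervalIntegrable _ _)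
        fun t _ => mul_le_mul_of_nonneg_left (hK' _) (hu0 _)
    rw [intervalIntegral.integral_mul_const, hftc] at hle
    have ha1 : Real.arctan 1 ≤ Real.arctan (v (τ x s) / ε) := by
      refine Real.arctan_mono ((le_div_iff₀ hε0).2 ?_)
      linarith [hε.2]
    have ha2 : Real.arctan (v (τ x (-s)) / ε) ≤ - Real.arctan 1 := by
      rw [← Real.arctan_neg]
      refine Real.arctan_mono ((div_le_iff₀ hε0).2 ?_)
      linarith [hε.2]
    rw [inv_mul_le_iff₀ hK0]
    linarith
  have hIc : Continuous fun x => ∫ t in -s..s, u (τ x t) :=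
    intervalIntegral.continuous_parametric_intervalIntegral_of_continuous'
      (f := fun x t => u (τ x t)) (hu.comp hτ) _ _
  have hIi : Integrable (fun x => ∫ t in -s..s, u (τ x t)) (torusMeasure κ) :=
    hIc.integrable_of_hasCompactSupport (HasCompactSupport.of_compactSpace _)
  have hfin : (torusMeasure κ).real U * (K⁻¹ * (2 * Real.arctan 1)) ≤
      (2 * s) * ∫ x, u x ∂torusMeasure κ := by
    calc (torusMeasure κ).real U * (K⁻¹ * (2 * Real.arctan 1))
        = ∫ x in U, K⁻¹ * (2 * Real.arctan 1) ∂torusMeasure κ := by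
          rw [setIntegral_const, smul_eq_mul]
      _ ≤ ∫ x in U, (∫ t in -s..s, u (τ x t)) ∂torusMeasure κ :=
          setIntegral_mono_on (integrable_const _) hIi.integrableOn hUo.measurableSet hlow
      _ ≤ ∫ x, (∫ t in -s..s, u (τ x t)) ∂torusMeasure κ :=
          setIntegral_le_integral hIi (ae_of_all _ hI0)
      _ = (2 * s) * ∫ x, u x ∂torusMeasure κ := by
          rw [hav, smul_eq_mul]; ring
  rw [inv_mul_le_iff₀ (by positivity)]
  exact hfin

end TorusLines

/-! ### Functions that are smooth along the fibres -/

section FibreSmooth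

variable {ι κ : Type} [DecidableEq ι] [DecidableEq κ]

/-- The function `u` is `n` times differentiable along the fibre coordinates on `Ω`, with
derivatives that are continuous on `Ω`. -/
def FibreSmooth (Ω : Set (UnitAddTorus (ι ⊕ κ))) : ℕ → (UnitAddTorus (ι ⊕ κ) → ℂ) → Prop
  | 0, u => ContinuousOn u Ω
  | n + 1, u => ContinuousOn u Ω ∧ ∀ j : κ, ∃ u', FibreSmooth Ω n u' ∧ ∀ x ∈ Ω,
      HasDerivAt (fun t : ℝ => u (x + Pi.single (Sum.inr j) (t : UnitAddCircle))) (u' x) 0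

variable {Ω : Set (UnitAddTorus (ι ⊕ κ))} {n : ℕ} {u v : UnitAddTorus (ι ⊕ κ) → ℂ}

theorem FibreSmooth.continuousOn (h : FibreSmooth Ω n u) : ContinuousOn u Ω := by
  cases n with
  | zero => exact h
  | succ n => exact h.1

theorem FibreSmooth.of_succ (h : FibreSmooth Ω (n + 1) u) : FibreSmooth Ω n u := by
  induction n generalizing u with
  | zero => exact h.1
  | succ n ih =>
    refine ⟨h.1, fun j => ?_⟩
    obtain ⟨u', h1, h2⟩ := h.2 j
    exact ⟨u', ih h1, h2⟩

theorem FibreSmooth.const (a : ℂ) : FibreSmooth Ω n fun _ => a := by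
  induction n generalizing a with
  | zero => exact continuousOn_const
  | succ n ih => exact ⟨continuousOn_const, fun j => ⟨_, ih 0, fun x _ => hasDerivAt_const _ _⟩⟩

theorem FibreSmooth.add (hu : FibreSmooth Ω n u) (hv : FibreSmooth Ω n v) :
    FibreSmooth Ω n fun x => u x + v x := by
  induction n generalizing u v with
  | zero => exact ContinuousOn.add hu hv
  | succ n ih =>
    refine ⟨hu.1.add hv.1, fun j => ?_⟩
    obtain ⟨u', hu1, hu2⟩ := hu.2 j
    obtain ⟨v', hv1, hv2⟩ := hv.2 j
    exact ⟨_, ih hu1 hv1, fun x hx => (hu2 x hx).add (hv2 x hx)⟩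

theorem FibreSmooth.sum {α : Type*} (s : Finset α) {u : α → UnitAddTorus (ι ⊕ κ) → ℂ}
    (h : ∀ i, FibreSmooth Ω n (u i)) : FibreSmooth Ω n fun x => ∑ i ∈ s, u i x := by
  classical
  induction s using Finset.induction_on with
  | empty => simpa using FibreSmooth.const 0
  | insert i s hi ih =>
    simp only [Finset.sum_insert hi]
    exact (h i).add ih

theorem FibreSmooth.mul (hu : FibreSmooth Ω n u) (hv : FibreSmooth Ω n v) :
    FibreSmooth Ω n fun x => u x * v x := by
  induction n generalizing u v with
  | zero => exact ContinuousOn.mul hu hv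
  | succ n ih =>
    refine ⟨hu.1.mul hv.1, fun j => ?_⟩
    obtain ⟨u', hu1, hu2⟩ := hu.2 j
    obtain ⟨v', hv1, hv2⟩ := hv.2 j
    refine ⟨_, (ih hu1 hv.of_succ).add (ih hu.of_succ hv1), fun x hx => ?_⟩
    convert! (hu2 x hx).mul (hv2 x hx) using 1
    simp

theorem FibreSmooth.inv (hu : FibreSmooth Ω n u) (h0 : ∀ x ∈ Ω, u x ≠ 0) :
    FibreSmooth Ω n fun x => (u x)⁻¹ := by
  induction n with
  | zero => exact ContinuousOn.inv₀ hu h0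
  | succ n ih =>
    refine ⟨hu.1.inv₀ h0, fun j => ?_⟩
    obtain ⟨u', hu1, hu2⟩ := hu.2 j
    have hi := ih hu.of_succ
    -- The derivative is written as a product of inverses, so that closure under products and the
    -- induction hypothesis apply.
    refine ⟨fun x => -1 * (u' x * ((u x)⁻¹ * (u x)⁻¹)),
      (FibreSmooth.const (-1)).mul (hu1.mul (hi.mul hi)), fun x hx => ?_⟩
    have := (hu2 x hx).fun_inv (by simpa using h0 x hx)
    convert! this using 1
    simp only [AddCircle.coe_zero, Pi.single_zero, add_zero]
    field_simp

variable [Fintype ι] [Fintype κ]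

theorem ExpDecay.fibreSmooth_symbol {c : (ι ⊕ κ → ℤ) → ℂ} (hc : ExpDecay c) :
    FibreSmooth Ω n fun x => (symbol c x : ℂ) := by
  have hcont : ∀ {c : (ι ⊕ κ → ℤ) → ℂ}, ExpDecay c → ContinuousOn (fun x => (symbol c x : ℂ)) Ω :=
    fun hc => (Complex.continuous_ofReal.comp hc.continuous_symbol).continuousOn
  induction n generalizing c with
  | zero => exact hcont hc
  | succ n ih =>
    exact ⟨hcont hc, fun j => ⟨_, ih (hc.diffCoeff (Sum.inr j)),
      fun x _ => (hc.hasDerivAt_symbol x (Sum.inr j)).ofReal_comp⟩⟩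

end FibreSmooth

/-! ### Boundary values of fibre integrals -/

section LimitingAbsorption

variable {ι κ : Type}

theorem continuous_elim_right (x₁ : UnitAddTorus ι) :
    Continuous fun x₂ : UnitAddTorus κ => (Sum.elim x₁ x₂ : UnitAddTorus (ι ⊕ κ)) := by
  refine continuous_pi fun k => ?_
  rcases k with k | k
  · exact continuous_const
  · exact continuous_apply k

variable [DecidableEq ι] [DecidableEq κ]

theorem elim_add_single (x₁ : UnitAddTorus ι) (x₂ : UnitAddTorus κ) (j : κ) (a : UnitAddCircle) :
    (Sum.elim x₁ (x₂ + Pi.single j a) : UnitAddTorus (ι ⊕ κ)) =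
      Sum.elim x₁ x₂ + Pi.single (Sum.inr j) a := by
  funext k
  rcases k with k | k
  · simp
  · by_cases hk : k = j
    · subst hk; simp
    · simp [hk]

variable [Fintype ι] [Fintype κ]

/-- The squared length of the fibre gradient plus the squared distance to the level `E`. -/
def fibreWeight (c : (ι ⊕ κ → ℤ) → ℂ) (E : ℝ) (x : UnitAddTorus (ι ⊕ κ)) : ℝ :=
  ∑ j, symbol (diffCoeff (Sum.inr j) c) x ^ 2 + (symbol c x - E) ^ 2

omit [DecidableEq ι] [DecidableEq κ] in
theorem ExpDecay.continuous_fibreWeight {c : (ι ⊕ κ → ℤ) → ℂ} (hc : ExpDecay c) (E : ℝ) :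
    Continuous (fibreWeight c E) := by
  have h1 := hc.continuous_symbol
  have h2 := fun j : κ => (hc.diffCoeff (Sum.inr j)).continuous_symbol
  unfold fibreWeight
  fun_prop

/-- Integration by parts along the fibres with the vector field `∇₂ f / q`, where `f` is the symbol
and `q` the weight. It trades a function of `z - f` for its antiderivative. -/
theorem exists_integral_by_parts {c : (ι ⊕ κ → ℤ) → ℂ} (hc : ExpDecay c) (E : ℝ) {n : ℕ}
    {b : UnitAddTorus (ι ⊕ κ) → ℂ} (hb : FibreSmooth {x | fibreWeight c E x ≠ 0} (n + 1) b) :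
    ∃ b', FibreSmooth {x | fibreWeight c E x ≠ 0} n b' ∧ ∀ (x₁ : UnitAddTorus ι),
      (∀ x₂ : UnitAddTorus κ, fibreWeight c E (Sum.elim x₁ x₂) ≠ 0) → ∀ z : ℂ, z.im ≠ 0 →
      ∀ Φ φ : ℂ → ℂ, (∀ w ∈ Complex.slitPlane, HasDerivAt Φ (φ w) w) →
      ContinuousOn φ Complex.slitPlane →
      ∫ x₂, b (Sum.elim x₁ x₂) * φ (z - symbol c (Sum.elim x₁ x₂)) ∂torusMeasure κ =
        (∫ x₂, b' (Sum.elim x₁ x₂) * Φ (z - symbol c (Sum.elim x₁ x₂)) ∂torusMeasure κ) +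
        ∫ x₂, b (Sum.elim x₁ x₂) * (((symbol c (Sum.elim x₁ x₂) - E) ^ 2 : ℝ) /
          fibreWeight c E (Sum.elim x₁ x₂)) * φ (z - symbol c (Sum.elim x₁ x₂)) ∂torusMeasure κ := by
  set Ω := {x | fibreWeight c E x ≠ 0}
  set q : UnitAddTorus (ι ⊕ κ) → ℂ := fun x => fibreWeight c E x
  set f : UnitAddTorus (ι ⊕ κ) → ℂ := fun x => symbol c x
  set g : κ → UnitAddTorus (ι ⊕ κ) → ℂ := fun j x => symbol (diffCoeff (Sum.inr j) c) x
  have hf : ∀ m, FibreSmooth Ω m f := fun m => hc.fibreSmooth_symbol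
  have hg : ∀ m j, FibreSmooth Ω m (g j) := fun m j => (hc.diffCoeff _).fibreSmooth_symbol
  have hq : ∀ m, FibreSmooth Ω m q := by
    intro m
    have h1 := ((hf m).add (FibreSmooth.const (-(E : ℂ))))
    have h2 := (FibreSmooth.sum Finset.univ fun j => (hg m j).mul (hg m j)).add (h1.mul h1)
    convert! h2 using 1
    funext x
    simp only [q, fibreWeight, f, g]
    push_cast
    ring_nf
  have hq0 : ∀ x ∈ Ω, q x ≠ 0 := fun x hx => Complex.ofReal_ne_zero.2 hx
  -- These are the components of `b` times the field `∇₂ f / q`. The term `(f - E) ^ 2` in `q` makes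
  -- `q` vanish only at fibre-critical points on the level `E`, instead of at all fibre-critical
  -- points.
  have hB : ∀ j, FibreSmooth Ω (n + 1) fun x => b x * (g j x * (q x)⁻¹) := fun j =>
    hb.mul ((hg _ j).mul ((hq _).inv hq0))
  choose B' hB' hB'd using fun j => (hB j).2 j
  refine ⟨fun x => ∑ j, B' j x, FibreSmooth.sum _ hB', fun x₁ hx₁ z hz Φ φ hΦ hφ => ?_⟩
  set p : UnitAddTorus κ → UnitAddTorus (ι ⊕ κ) := fun x₂ => Sum.elim x₁ x₂
  have hpΩ : ∀ x₂, p x₂ ∈ Ω := hx₁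
  have hp : Continuous p := continuous_elim_right x₁
  have hres : ∀ {u : UnitAddTorus (ι ⊕ κ) → ℂ} {m : ℕ}, FibreSmooth Ω m u → Continuous (u ∘ p) :=
    fun hu => hu.continuousOn.comp_continuous hp hpΩ
  have hslit : ∀ x, z - f x ∈ Complex.slitPlane := fun x =>
    Complex.mem_slitPlane_iff.2 (Or.inr (by simpa [f] using hz))
  have hfc : Continuous fun x₂ => z - f (p x₂) := continuous_const.sub (hres (hf 0))
  have hφc : Continuous fun x₂ => φ (z - f (p x₂)) := hφ.comp_continuous hfc fun _ => hslit _
  have hΦc : Continuous fun x₂ => Φ (z - f (p x₂)) :=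
    (ContinuousOn.comp_continuous (f := fun x₂ => z - f (p x₂)) (g := Φ)
      (fun w hw => (hΦ w hw).continuousAt.continuousWithinAt) hfc fun _ => hslit _)
  have hint : ∀ {u : UnitAddTorus κ → ℂ}, Continuous u → Integrable u (torusMeasure κ) :=
    fun hu => hu.integrable_of_hasCompactSupport (HasCompactSupport.of_compactSpace _)
  have hparts : ∀ j, ∫ x₂, (B' j (p x₂) * Φ (z - f (p x₂)) -
      b (p x₂) * (g j (p x₂) * (q (p x₂))⁻¹) * (φ (z - f (p x₂)) * g j (p x₂))) ∂torusMeasure κ = 0 := by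
    intro j
    have hBc := hres (hB j)
    have hgc := hres (hg 0 j)
    have hB'c := hres (hB' j)
    refine integral_deriv_line_eq_zero (j := j)
      (v := fun x₂ => b (p x₂) * (g j (p x₂) * (q (p x₂))⁻¹) * Φ (z - f (p x₂))) ?_ fun x₂ => ?_
    · exact (hB'c.mul hΦc).sub (hBc.mul (hφc.mul hgc))
    · have h1 := hB'd j (p x₂) (hpΩ x₂)
      have h2 : HasDerivAt (fun t : ℝ => z - f (p x₂ + Pi.single (Sum.inr j) (t : UnitAddCircle)))
          (-g j (p x₂)) 0 :=
        ((hc.hasDerivAt_symbol (p x₂) (Sum.inr j)).ofReal_comp).const_sub z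
      have h3 := HasDerivAt.comp (0 : ℝ) (hΦ _ (by simpa using hslit (p x₂))) h2
      have h4 := h1.mul h3
      simp only [p, elim_add_single]
      convert! h4 using 1
      simp only [Function.comp, AddCircle.coe_zero, Pi.single_zero, add_zero, p]
      ring
  have hsum := Finset.sum_congr rfl fun j (_ : j ∈ Finset.univ) => hparts j
  rw [Finset.sum_const_zero, ← integral_finsetSum] at hsum
  swap
  · intro j _
    exact hint (((hres (hB' j)).mul hΦc).sub ((hres (hB j)).mul (hφc.mul (hres (hg 0 j)))))
  have hqc := hres ((hq 0).inv hq0)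
  have hbc := hres hb
  have hfr := hres (hf 0)
  have hrc : Continuous fun x₂ => (((symbol c (p x₂) - E) ^ 2 : ℝ) / fibreWeight c E (p x₂) : ℂ) := by
    have h := (hc.continuous_symbol.comp hp)
    have h' := (hc.continuous_fibreWeight E).comp hp
    refine Continuous.div (Complex.continuous_ofReal.comp ((h.sub continuous_const).pow 2))
      (Complex.continuous_ofReal.comp h') fun x₂ => Complex.ofReal_ne_zero.2 (hx₁ x₂)
  have hb'c : Continuous fun x₂ => ∑ j, B' j (p x₂) := continuous_finsetSum _ fun j _ => hres (hB' j)
  -- The identity is `∑ g_j ^ 2 / q = 1 - (f - E) ^ 2 / q`. The remainder carries a factor `(f - E)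
  -- ^ 2`, which compensates the singularity of `φ` at the level `E`.
  have hpt : ∀ x₂, b (p x₂) * φ (z - f (p x₂)) =
      ((∑ j, B' j (p x₂)) * Φ (z - f (p x₂)) +
        b (p x₂) * (((symbol c (p x₂) - E) ^ 2 : ℝ) / fibreWeight c E (p x₂)) * φ (z - f (p x₂))) -
      ∑ j, (B' j (p x₂) * Φ (z - f (p x₂)) -
      b (p x₂) * (g j (p x₂) * (q (p x₂))⁻¹) * (φ (z - f (p x₂)) * g j (p x₂))) := by
    intro x₂
    rw [Finset.sum_sub_distrib, ← Finset.sum_mul]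
    have h1 : ∑ j, b (p x₂) * (g j (p x₂) * (q (p x₂))⁻¹) * (φ (z - f (p x₂)) * g j (p x₂)) =
        b (p x₂) * φ (z - f (p x₂)) * (q (p x₂))⁻¹ * ∑ j, g j (p x₂) ^ 2 := by
      rw [Finset.mul_sum]
      exact Finset.sum_congr rfl fun j _ => by ring
    have h2 : q (p x₂) = ∑ j, g j (p x₂) ^ 2 + ((symbol c (p x₂) - E) ^ 2 : ℝ) := by
      simp only [q, fibreWeight, g]
      push_cast
      rfl
    have h3 : ((symbol c (p x₂) - E) ^ 2 : ℝ) = q (p x₂) - ∑ j, g j (p x₂) ^ 2 := by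
      rw [h2]; ring
    have h4 := hq0 _ (hpΩ x₂)
    rw [h1, h3, show (fibreWeight c E (p x₂) : ℂ) = q (p x₂) from rfl]
    field_simp
    ring
  change ∫ x₂, b (p x₂) * φ (z - f (p x₂)) ∂torusMeasure κ = _
  rw [integral_congr_ae (ae_of_all _ hpt), integral_sub, integral_add, hsum, sub_zero]
  · exact hint (hb'c.mul hΦc)
  · exact hint ((hbc.mul hrc).mul hφc)
  · exact hint ((hb'c.mul hΦc).add ((hbc.mul hrc).mul hφc))
  · refine hint (continuous_finsetSum _ fun j _ => ?_)
    exact ((hres (hB' j)).mul hΦc).sub ((hres (hB j)).mul (hφc.mul (hres (hg 0 j))))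

end LimitingAbsorption

/-! ### Boundary values of the logarithm -/

section LogBounds

/-- Apply `log t ≤ t - 1` to `x` and to `x⁻¹`. -/
theorem mul_abs_log_le {x : ℝ} (hx : 0 < x) : x * |Real.log x| ≤ 1 + x ^ 2 := by
  have h1 := Real.log_le_sub_one_of_pos hx
  have h2 := Real.log_le_sub_one_of_pos (inv_pos.2 hx)
  rw [Real.log_inv] at h2
  have h3 : x * x⁻¹ = 1 := mul_inv_cancel₀ hx.ne'
  rcases abs_cases (Real.log x) with ⟨h, _⟩ | ⟨h, _⟩ <;> rw [h] <;> nlinarith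

theorem norm_mul_norm_log_le {w : ℂ} (hw : w ≠ 0) :
    ‖w‖ * ‖Complex.log w‖ ≤ 1 + ‖w‖ ^ 2 + Real.pi * ‖w‖ := by
  have h1 : ‖Complex.log w‖ ≤ |Real.log ‖w‖| + Real.pi := by
    refine (Complex.norm_le_abs_re_add_abs_im _).trans ?_
    rw [Complex.log_re, Complex.log_im]
    gcongr
    exact Complex.abs_arg_le_pi w
  have h2 := mul_abs_log_le (norm_pos_iff.2 hw)
  nlinarith [norm_nonneg w]

variable {s ε : ℝ}

theorem add_mul_I_ne_zero (s : ℝ) (hε : 0 < ε) : (s + ε * Complex.I : ℂ) ≠ 0 := by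
  intro h
  have := congrArg Complex.im h
  simp at this
  exact hε.ne' this

theorem abs_le_norm_add_mul_I (s ε : ℝ) : |s| ≤ ‖(s + ε * Complex.I : ℂ)‖ := by
  simpa using Complex.abs_re_le_norm (s + ε * Complex.I : ℂ)

theorem norm_add_mul_I_le {S : ℝ} (hs : |s| ≤ S) (hε : 0 < ε) (hε1 : ε ≤ 1) :
    ‖(s + ε * Complex.I : ℂ)‖ ≤ S + 1 := by
  refine (norm_add_le _ _).trans ?_
  rw [norm_mul, Complex.norm_I, mul_one, Complex.norm_real, Complex.norm_real, Real.norm_eq_abs,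
    Real.norm_eq_abs, abs_of_pos hε]
  linarith

theorem tendsto_add_mul_I (s : ℝ) :
    Tendsto (fun ε : ℝ => (s + ε * Complex.I : ℂ)) (𝓝[>] 0) (𝓝 s) := by
  have : Continuous fun ε : ℝ => (s + ε * Complex.I : ℂ) := by fun_prop
  simpa using (this.tendsto 0).mono_left nhdsWithin_le_nhds

theorem exists_tendsto_log_add_mul_I (hs : s ≠ 0) :
    ∃ ℓ, Tendsto (fun ε : ℝ => Complex.log (s + ε * Complex.I)) (𝓝[>] 0) (𝓝 ℓ) := by
  refine ⟨Complex.log s, ?_⟩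
  -- For `s < 0` the limit is on the branch cut. The principal logarithm is continuous there from
  -- the closed upper half-plane, which contains the approach.
  have hin : Tendsto (fun ε : ℝ => (s + ε * Complex.I : ℂ)) (𝓝[>] 0) (𝓝[{z | 0 ≤ z.im}] s) := by
    refine tendsto_nhdsWithin_iff.2 ⟨tendsto_add_mul_I s, ?_⟩
    filter_upwards [self_mem_nhdsWithin] with ε hε
    have : 0 ≤ ε := (Set.mem_Ioi.1 hε).le
    simpa using this
  rcases hs.lt_or_gt with h | h
  · exact (Complex.continuousWithinAt_log_of_re_neg_of_im_zero (by simpa using h) (by simp)).tendsto.comp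
      hin
  · exact (continuousAt_clog (Or.inl (by simpa using h))).tendsto.comp (tendsto_add_mul_I s)

/-- A family of functions `H s w` that has bounded boundary values at `w = s + i0`. -/
structure HasBoundaryValues (H : ℝ → ℂ → ℂ) : Prop where
  bounded : ∀ S, ∃ C, ∀ s ε : ℝ, |s| ≤ S → 0 < ε → ε ≤ 1 → ‖H s (s + ε * Complex.I)‖ ≤ C
  tendsto : ∀ s : ℝ, ∃ ℓ, Tendsto (fun ε : ℝ => H s (s + ε * Complex.I)) (𝓝[>] 0) (𝓝 ℓ)
  continuous : ∀ ε : ℝ, 0 < ε → Continuous fun s : ℝ => H s (s + ε * Complex.I)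

theorem continuous_log_add_mul_I (hε : 0 < ε) :
    Continuous fun s : ℝ => Complex.log (s + ε * Complex.I) := by
  refine Continuous.clog (by fun_prop) fun s => ?_
  exact Complex.mem_slitPlane_iff.2 (Or.inr (by simpa using hε.ne'))

theorem hasBoundaryValues_mul_log :
    HasBoundaryValues fun _ w => w * Complex.log w - w where
  bounded S := by
    refine ⟨1 + (S + 1) ^ 2 + Real.pi * (S + 1) + (S + 1), fun s ε hs hε hε1 => ?_⟩
    have h1 := norm_add_mul_I_le hs hε hε1
    have h2 := norm_mul_norm_log_le (add_mul_I_ne_zero s hε)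
    refine (norm_sub_le _ _).trans ?_
    rw [norm_mul]
    have h3 := Real.pi_pos
    have h4 := norm_nonneg (s + ε * Complex.I : ℂ)
    nlinarith
  tendsto s := by
    rcases eq_or_ne s 0 with rfl | hs
    · have h1 := tendsto_add_mul_I 0
      have h2 : Tendsto (fun ε : ℝ => ((0 : ℝ) + ε * Complex.I : ℂ) *
          Complex.log ((0 : ℝ) + ε * Complex.I)) (𝓝[>] 0) (𝓝 0) := by
        rw [tendsto_zero_iff_norm_tendsto_zero]
        have h3 : Tendsto (fun ε : ℝ => |Real.log ε * ε| + Real.pi * ε) (𝓝[>] 0) (𝓝 0) := by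
          have h4 : Tendsto (fun ε : ℝ => |Real.log ε * ε|) (𝓝[>] 0) (𝓝 0) := by
            simp_rw [mul_comm (Real.log _)]
            simpa using (Real.continuous_mul_log.abs.tendsto 0).mono_left nhdsWithin_le_nhds
          have h5 : Tendsto (fun ε : ℝ => Real.pi * ε) (𝓝[>] 0) (𝓝 0) := by
            have : Continuous fun ε : ℝ => Real.pi * ε := by fun_prop
            simpa using (this.tendsto 0).mono_left nhdsWithin_le_nhds
          simpa only [add_zero] using h4.add h5
        refine squeeze_zero' (Eventually.of_forall fun _ => norm_nonneg _) ?_ h3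
        filter_upwards [self_mem_nhdsWithin] with ε hε
        have hε : 0 < ε := hε
        have h6 : ‖((0 : ℝ) + ε * Complex.I : ℂ)‖ = ε := by
          simp [abs_of_pos hε]
        rw [norm_mul, h6]
        have h7 : ‖Complex.log ((0 : ℝ) + ε * Complex.I : ℂ)‖ ≤ |Real.log ε| + Real.pi := by
          refine (Complex.norm_le_abs_re_add_abs_im _).trans ?_
          rw [Complex.log_re, Complex.log_im, h6]
          gcongr
          exact Complex.abs_arg_le_pi _
        rw [abs_mul, abs_of_pos hε]
        nlinarith
      exact ⟨_, h2.sub h1⟩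
    · obtain ⟨ℓ, hℓ⟩ := exists_tendsto_log_add_mul_I hs
      exact ⟨_, ((tendsto_add_mul_I s).mul hℓ).sub (tendsto_add_mul_I s)⟩
  continuous ε hε := by
    have := continuous_log_add_mul_I hε
    fun_prop

/-- One factor `|s| ≤ |w|` tames the logarithm. At `s = 0` the function is identically zero in `ε`,
so its limit there is trivial. -/
theorem hasBoundaryValues_sq_mul_log :
    HasBoundaryValues fun s w => (s : ℂ) ^ 2 * Complex.log w where
  bounded S := by
    refine ⟨(S + 1) * (1 + (S + 1) ^ 2 + Real.pi * (S + 1)), fun s ε hs hε hε1 => ?_⟩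
    have h1 := norm_add_mul_I_le hs hε hε1
    have h2 := norm_mul_norm_log_le (add_mul_I_ne_zero s hε)
    have h3 := abs_le_norm_add_mul_I s ε
    have h4 := Real.pi_pos
    have hS : 0 ≤ S := (abs_nonneg _).trans hs
    rw [norm_mul, norm_pow, Complex.norm_real, Real.norm_eq_abs]
    calc |s| ^ 2 * ‖Complex.log (s + ε * Complex.I)‖
        ≤ ‖(s + ε * Complex.I : ℂ)‖ ^ 2 * ‖Complex.log (s + ε * Complex.I)‖ := by gcongr
      _ = ‖(s + ε * Complex.I : ℂ)‖ * (‖(s + ε * Complex.I : ℂ)‖ *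
            ‖Complex.log (s + ε * Complex.I)‖) := by ring
      _ ≤ (S + 1) * (1 + (S + 1) ^ 2 + Real.pi * (S + 1)) := by
          refine mul_le_mul h1 (h2.trans ?_) (by positivity) (by positivity)
          gcongr
  tendsto s := by
    rcases eq_or_ne s 0 with rfl | hs
    · exact ⟨0, by simp⟩
    · obtain ⟨ℓ, hℓ⟩ := exists_tendsto_log_add_mul_I hs
      exact ⟨_, hℓ.const_mul _⟩
  continuous ε hε := by
    have := continuous_log_add_mul_I hε
    fun_prop

/-- One factor `|s| ≤ |w|` cancels the inverse, and at `s = 0` the function vanishes for every `ε`.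
-/
theorem hasBoundaryValues_sq_mul_inv : HasBoundaryValues fun s w => (s : ℂ) ^ 2 * w⁻¹ where
  bounded S := by
    refine ⟨S + 1, fun s ε hs hε hε1 => ?_⟩
    have h1 := norm_add_mul_I_le hs hε hε1
    have h3 := abs_le_norm_add_mul_I s ε
    have h5 := norm_pos_iff.2 (add_mul_I_ne_zero s hε)
    rw [norm_mul, norm_pow, Complex.norm_real, Real.norm_eq_abs, norm_inv, ← div_eq_mul_inv,
      div_le_iff₀ h5]
    nlinarith [abs_nonneg s]
  tendsto s := by
    rcases eq_or_ne s 0 with rfl | hs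
    · exact ⟨0, by simp⟩
    · exact ⟨_, ((tendsto_add_mul_I s).inv₀ (Complex.ofReal_ne_zero.2 hs)).const_mul _⟩
  continuous ε hε := by
    refine Continuous.mul (by fun_prop) (Continuous.inv₀ (by fun_prop) fun s => ?_)
    exact add_mul_I_ne_zero s hε

end LogBounds

/-! ### The fibre integrals of the resolvent -/

section FibreGreen

variable {ι κ : Type}

theorem continuous_elim_left (x₂ : UnitAddTorus κ) :
    Continuous fun x₁ : UnitAddTorus ι => (Sum.elim x₁ x₂ : UnitAddTorus (ι ⊕ κ)) := by
  refine continuous_pi fun k => ?_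
  rcases k with k | k
  · exact continuous_apply k
  · exact continuous_const

variable [Fintype ι] [Fintype κ]

/-- The function of `x₁` that represents the restricted resolvent as a multiplication operator. -/
def fibreGreen (c : (ι ⊕ κ → ℤ) → ℂ) (z : ℂ) (x₁ : UnitAddTorus ι) : ℂ :=
  ∫ x₂ : UnitAddTorus κ, (z - symbol c (Sum.elim x₁ x₂))⁻¹ ∂torusMeasure κ

/-- The points whose fibres meet the level `E` nowhere critically, quantified by `n`. -/
def regularSet (c : (ι ⊕ κ → ℤ) → ℂ) (E : ℝ) (n : ℕ) : Set (UnitAddTorus ι) :=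
  {x₁ | ∀ x₂ : UnitAddTorus κ, 1 / ((n : ℝ) + 1) ≤ fibreWeight c E (Sum.elim x₁ x₂)}

variable {c : (ι ⊕ κ → ℤ) → ℂ} {E : ℝ}

theorem regularSet_mono : Monotone (regularSet c E) := fun m n hmn x₁ h x₂ =>
  (one_div_le_one_div_of_le (by positivity) (by gcongr)).trans (h x₂)

theorem ExpDecay.isClosed_regularSet (hc : ExpDecay c) (n : ℕ) : IsClosed (regularSet c E n) := by
  simp only [regularSet, Set.ofPred_forall]
  exact isClosed_iInter fun x₂ => isClosed_le continuous_const
    ((hc.continuous_fibreWeight E).comp (continuous_elim_left x₂))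

theorem fibreWeight_nonneg (x : UnitAddTorus (ι ⊕ κ)) : 0 ≤ fibreWeight c E x :=
  add_nonneg (Finset.sum_nonneg fun _ _ => sq_nonneg _) (sq_nonneg _)

theorem fibreWeight_eq_zero_iff {x : UnitAddTorus (ι ⊕ κ)} : fibreWeight c E x = 0 ↔
    symbol c x = E ∧ ∀ j, symbol (diffCoeff (Sum.inr j) c) x = 0 := by
  rw [fibreWeight, add_eq_zero_iff_of_nonneg (Finset.sum_nonneg fun _ _ => sq_nonneg _)
    (sq_nonneg _), Finset.sum_eq_zero_iff_of_nonneg fun _ _ => sq_nonneg _, and_comm]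
  simp [sub_eq_zero]

/-- Off the null set of critical fibres the weight is positive on the whole fibre. By compactness it
has a positive minimum there, which exceeds some `1 / (n + 1)`. -/
theorem ExpDecay.ae_mem_regularSet (hc : ExpDecay c) (hE : NonCritical c E) :
    ∀ᵐ x₁ ∂torusMeasure ι, ∃ n, x₁ ∈ regularSet c E n := by
  refine measure_mono_null (fun x₁ hx₁ => ?_) (torusMeasure_criticalFibres hc hE)
  by_contra hcon
  have h0 : ∀ x₂ : UnitAddTorus κ, 0 < fibreWeight c E (Sum.elim x₁ x₂) := by
    intro x₂
    refine lt_of_le_of_ne (fibreWeight_nonneg _) fun h => hcon ⟨x₂, ?_⟩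
    exact fibreWeight_eq_zero_iff.1 h.symm
  obtain ⟨x₂, -, hx₂⟩ := isCompact_univ.exists_isMinOn Set.univ_nonempty
    ((hc.continuous_fibreWeight E).comp (continuous_elim_right x₁)).continuousOn
  obtain ⟨n, hn⟩ := exists_nat_one_div_lt (h0 x₂)
  exact hx₁ ⟨n, fun y => hn.le.trans (hx₂ (Set.mem_univ y))⟩

theorem fibreWeight_ne_zero_of_mem {n : ℕ} {x₁ : UnitAddTorus ι} (h : x₁ ∈ regularSet c E n)
    (x₂ : UnitAddTorus κ) : fibreWeight c E (Sum.elim x₁ x₂) ≠ 0 :=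
  ((by positivity : (0 : ℝ) < 1 / ((n : ℝ) + 1)).trans_le (h x₂)).ne'

/-- The fibre integral of `β H(E - f, E - f + iε)`, where `f` is the symbol. -/
def fibreIntegral (c : (ι ⊕ κ → ℤ) → ℂ) (E : ℝ) (H : ℝ → ℂ → ℂ) (β : UnitAddTorus (ι ⊕ κ) → ℂ)
    (x₁ : UnitAddTorus ι) (ε : ℝ) : ℂ :=
  ∫ x₂ : UnitAddTorus κ, β (Sum.elim x₁ x₂) * H (E - symbol c (Sum.elim x₁ x₂))
    ((E - symbol c (Sum.elim x₁ x₂) : ℝ) + ε * Complex.I) ∂torusMeasure κ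

/-- The fibre integrals of functions with bounded boundary values are locally uniformly bounded
and converge. -/
theorem ExpDecay.fibreIntegral_boundaryValues (hc : ExpDecay c) {H : ℝ → ℂ → ℂ}
    (hH : HasBoundaryValues H) {β : UnitAddTorus (ι ⊕ κ) → ℂ}
    (hβ : ContinuousOn β {x | fibreWeight c E x ≠ 0}) (n : ℕ) :
    (∃ M, ∀ x₁ ∈ regularSet c E n, ∀ ε : ℝ, 0 < ε → ε ≤ 1 → ‖fibreIntegral c E H β x₁ ε‖ ≤ M) ∧
    ∀ x₁ ∈ regularSet c E n, ∃ ℓ, Tendsto (fibreIntegral c E H β x₁) (𝓝[>] 0) (𝓝 ℓ) := by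
  have hcomp : IsCompact {x | 1 / ((n : ℝ) + 1) ≤ fibreWeight c E x} :=
    (isClosed_le continuous_const (hc.continuous_fibreWeight E)).isCompact
  -- `β` may blow up where the weight vanishes, but it is bounded on the compact set where the
  -- weight is at least `1 / (n + 1)`.
  obtain ⟨B, hB⟩ := hcomp.exists_bound_of_continuousOn (hβ.mono fun x hx =>
    ((by positivity : (0 : ℝ) < 1 / ((n : ℝ) + 1)).trans_le hx).ne')
  obtain ⟨S, hS⟩ := (isCompact_range (continuous_const.sub hc.continuous_symbol :
    Continuous fun x => E - symbol c x)).isBounded.exists_norm_le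
  obtain ⟨C, hC⟩ := hH.bounded S
  have hbound : ∀ x₁ ∈ regularSet c E n, ∀ ε : ℝ, 0 < ε → ε ≤ 1 → ∀ x₂,
      ‖β (Sum.elim x₁ x₂) * H (E - symbol c (Sum.elim x₁ x₂))
        ((E - symbol c (Sum.elim x₁ x₂) : ℝ) + ε * Complex.I)‖ ≤ B * C := by
    intro x₁ hx₁ ε hε hε1 x₂
    rw [norm_mul]
    have h1 := hB _ (hx₁ x₂)
    exact mul_le_mul h1 (hC _ _ (hS _ ⟨_, rfl⟩) hε hε1) (norm_nonneg _) ((norm_nonneg _).trans h1)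
  refine ⟨⟨B * C, fun x₁ hx₁ ε hε hε1 => ?_⟩, fun x₁ hx₁ => ?_⟩
  · refine (norm_integral_le_of_norm_le_const (ae_of_all _ (hbound x₁ hx₁ ε hε hε1))).trans ?_
    simp
  · choose ℓ hℓ using hH.tendsto
    refine ⟨∫ x₂, β (Sum.elim x₁ x₂) * ℓ (E - symbol c (Sum.elim x₁ x₂)) ∂torusMeasure κ, ?_⟩
    refine tendsto_integral_filter_of_dominated_convergence (fun _ => B * C) ?_ ?_
      (integrable_const _) (ae_of_all _ fun x₂ => (hℓ _).const_mul _)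
    · filter_upwards [self_mem_nhdsWithin] with ε hε
      have h1 : Continuous fun x₂ => β (Sum.elim x₁ x₂) :=
        hβ.comp_continuous (continuous_elim_right x₁) (fibreWeight_ne_zero_of_mem hx₁)
      have h2 := (hH.continuous ε hε).comp (continuous_const.sub
        (hc.continuous_symbol.comp (continuous_elim_right x₁)) : Continuous fun x₂ =>
          E - symbol c (Sum.elim x₁ x₂))
      exact (h1.mul h2).aestronglyMeasurable
    · filter_upwards [Ioc_mem_nhdsGT zero_lt_one] with ε hε
      exact ae_of_all _ (hbound x₁ hx₁ ε hε.1 hε.2)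

/-- The limiting absorption principle for the fibre integrals of the resolvent. -/
theorem ExpDecay.fibreGreen_boundaryValues (hc : ExpDecay c) (n : ℕ) :
    (∃ M, ∀ x₁ ∈ regularSet c E n, ∀ ε : ℝ, 0 < ε → ε ≤ 1 →
      ‖fibreGreen c (E + ε * Complex.I) x₁‖ ≤ M) ∧
    ∀ x₁ ∈ regularSet c E n, ∃ ℓ, Tendsto (fun ε : ℝ => fibreGreen c (E + ε * Complex.I) x₁)
      (𝓝[>] 0) (𝓝 ℓ) := by
  classical
  -- Two integrations by parts follow the chain of antiderivatives `1/w`, `log w`, `w log w - w`. A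
  -- single one would leave the unbounded `log w`. After the second, all three terms have bounded
  -- boundary values.
  obtain ⟨b₁, hb₁, h₁⟩ := exists_integral_by_parts hc E (n := 1) (FibreSmooth.const 1)
  obtain ⟨b₂, hb₂, h₂⟩ := exists_integral_by_parts hc E (n := 0) hb₁
  have hq : ContinuousOn (fun x => ((fibreWeight c E x : ℂ))⁻¹) {x | fibreWeight c E x ≠ 0} :=
    ContinuousOn.inv₀ (Complex.continuous_ofReal.comp (hc.continuous_fibreWeight E)).continuousOn
      fun x hx => Complex.ofReal_ne_zero.2 hx
  obtain ⟨⟨M₁, hM₁⟩, hℓ₁⟩ := hc.fibreIntegral_boundaryValues hasBoundaryValues_mul_log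
    hb₂.continuousOn n
  obtain ⟨⟨M₂, hM₂⟩, hℓ₂⟩ := hc.fibreIntegral_boundaryValues hasBoundaryValues_sq_mul_log
    (hb₁.continuousOn.mul hq) n
  obtain ⟨⟨M₃, hM₃⟩, hℓ₃⟩ := hc.fibreIntegral_boundaryValues hasBoundaryValues_sq_mul_inv hq n
  have hw : ∀ (ε : ℝ) (x : UnitAddTorus (ι ⊕ κ)), (E + ε * Complex.I - symbol c x : ℂ) =
      (E - symbol c x : ℝ) + ε * Complex.I := fun ε x => by push_cast; ring
  have hs : ∀ x : UnitAddTorus (ι ⊕ κ), (((symbol c x - E) ^ 2 : ℝ) / fibreWeight c E x : ℂ) =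
      (fibreWeight c E x : ℂ)⁻¹ * ((E - symbol c x : ℝ) : ℂ) ^ 2 := fun x => by
    push_cast; rw [div_eq_inv_mul]; ring
  have key : ∀ x₁ ∈ regularSet c E n, ∀ ε : ℝ, 0 < ε → fibreGreen c (E + ε * Complex.I) x₁ =
      fibreIntegral c E (fun _ w => w * Complex.log w - w) b₂ x₁ ε +
      fibreIntegral c E (fun s w => (s : ℂ) ^ 2 * Complex.log w)
        (b₁ * fun x => ((fibreWeight c E x : ℂ))⁻¹) x₁ ε +
      fibreIntegral c E (fun s w => (s : ℂ) ^ 2 * w⁻¹)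
        (fun x => ((fibreWeight c E x : ℂ))⁻¹) x₁ ε := by
    intro x₁ hx₁ ε hε
    have hz : (E + ε * Complex.I : ℂ).im ≠ 0 := by simpa using hε.ne'
    have e₁ := h₁ x₁ (fibreWeight_ne_zero_of_mem hx₁) (E + ε * Complex.I) hz Complex.log (fun w => w⁻¹)
      (fun w hw => Complex.hasDerivAt_log hw)
      (continuousOn_id.inv₀ fun w hw => Complex.slitPlane_ne_zero hw)
    have e₂ := h₂ x₁ (fibreWeight_ne_zero_of_mem hx₁) (E + ε * Complex.I) hz
      (fun w => w * Complex.log w - w) Complex.log (fun w hw => by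
        have := ((hasDerivAt_id w).mul (Complex.hasDerivAt_log hw)).sub (hasDerivAt_id w)
        convert! this using 1
        have := Complex.slitPlane_ne_zero hw
        simp [this])
      (fun w hw => (continuousAt_clog hw).continuousWithinAt)
    rw [e₂] at e₁
    simp only [one_mul, hw, hs] at e₁
    simpa only [fibreGreen, fibreIntegral, Pi.mul_apply, hw, mul_assoc] using e₁
  refine ⟨⟨M₁ + M₂ + M₃, fun x₁ hx₁ ε hε hε1 => ?_⟩, fun x₁ hx₁ => ?_⟩
  · rw [key x₁ hx₁ ε hε]
    refine (norm_add₃_le).trans ?_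
    gcongr
    exacts [hM₁ x₁ hx₁ ε hε hε1, hM₂ x₁ hx₁ ε hε hε1, hM₃ x₁ hx₁ ε hε hε1]
  · obtain ⟨ℓ₁, h1⟩ := hℓ₁ x₁ hx₁
    obtain ⟨ℓ₂, h2⟩ := hℓ₂ x₁ hx₁
    obtain ⟨ℓ₃, h3⟩ := hℓ₃ x₁ hx₁
    refine ⟨ℓ₁ + ℓ₂ + ℓ₃, ((h1.add h2).add h3).congr' ?_⟩
    filter_upwards [self_mem_nhdsWithin] with ε hε using (key x₁ hx₁ ε hε).symm

theorem ExpDecay.continuous_resolvent_fibre (hc : ExpDecay c) {z : ℂ} (hz : z.im ≠ 0) :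
    Continuous fun x : UnitAddTorus (ι ⊕ κ) => (z - symbol c x)⁻¹ := by
  refine Continuous.inv₀ (continuous_const.sub (Complex.continuous_ofReal.comp
    hc.continuous_symbol)) fun x h => hz ?_
  have := congrArg Complex.im h
  simpa using this

theorem ExpDecay.im_fibreGreen (hc : ExpDecay c) {ε : ℝ} (hε : 0 < ε) (x₁ : UnitAddTorus ι) :
    (fibreGreen c (E + ε * Complex.I) x₁).im =
      -∫ x₂, ε / ((symbol c (Sum.elim x₁ x₂) - E) ^ 2 + ε ^ 2) ∂torusMeasure κ := by
  have hcont := (hc.continuous_resolvent_fibre (z := E + ε * Complex.I)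
    (by simpa using hε.ne')).comp (continuous_elim_right (κ := κ) x₁)
  have hint := hcont.integrable_of_hasCompactSupport (μ := torusMeasure κ)
    (HasCompactSupport.of_compactSpace _)
  have h1 := (integral_im hint).symm
  change (∫ x₂, _ ∂torusMeasure κ : ℂ).im = _
  refine h1.trans ?_
  rw [← integral_neg]
  refine integral_congr_ae (ae_of_all _ fun x₂ => ?_)
  simp only [Function.comp, RCLike.im_to_complex, Complex.inv_im, Complex.normSq_apply]
  simp
  ring

/-- By compactness the symbol stays away from `E` on the fibre, so the Poisson kernel is `O(ε)`
uniformly. -/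
theorem ExpDecay.tendsto_im_fibreGreen_of_notMem (hc : ExpDecay c) {x₁ : UnitAddTorus ι}
    (hx₁ : ∀ x₂ : UnitAddTorus κ, symbol c (Sum.elim x₁ x₂) ≠ E) :
    Tendsto (fun ε : ℝ => (fibreGreen c (E + ε * Complex.I) x₁).im) (𝓝[>] 0) (𝓝 0) := by
  have hf : Continuous fun x₂ : UnitAddTorus κ => (symbol c (Sum.elim x₁ x₂) - E) ^ 2 := by
    have := hc.continuous_symbol.comp (continuous_elim_right (κ := κ) x₁)
    simp only [Function.comp_def] at this
    fun_prop
  obtain ⟨y, -, hy⟩ := isCompact_univ.exists_isMinOn Set.univ_nonempty hf.continuousOn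
  set δ := (symbol c (Sum.elim x₁ y) - E) ^ 2
  have hδ : 0 < δ := by
    have := sub_ne_zero.2 (hx₁ y)
    positivity
  have hlim : Tendsto (fun ε : ℝ => ε / δ) (𝓝[>] 0) (𝓝 0) := by
    have : Continuous fun ε : ℝ => ε / δ := by fun_prop
    simpa using (this.tendsto 0).mono_left nhdsWithin_le_nhds
  refine squeeze_zero_norm' ?_ hlim
  filter_upwards [self_mem_nhdsWithin] with ε hε
  have hε : 0 < ε := hε
  rw [hc.im_fibreGreen hε, norm_neg]
  refine (norm_integral_le_of_norm_le_const (C := ε / δ) (ae_of_all _ fun x₂ => ?_)).trans (by simp)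
  rw [Real.norm_eq_abs, abs_of_nonneg (by positivity)]
  have : δ ≤ (symbol c (Sum.elim x₁ x₂) - E) ^ 2 := hy (Set.mem_univ x₂)
  gcongr
  nlinarith

/-- On a regular fibre some fibre derivative is nonzero at a point of the level set. The Poisson
integrals are then bounded below by a positive constant as `ε ↓ 0`. -/
theorem ExpDecay.im_limit_neg (hc : ExpDecay c) {n : ℕ} {x₁ : UnitAddTorus ι}
    (hx₁ : x₁ ∈ regularSet c E n) (h : ∃ x₂ : UnitAddTorus κ, symbol c (Sum.elim x₁ x₂) = E)
    {ℓ : ℂ} (hℓ : Tendsto (fun ε : ℝ => fibreGreen c (E + ε * Complex.I) x₁) (𝓝[>] 0) (𝓝 ℓ)) :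
    ℓ.im < 0 := by
  classical
  obtain ⟨x₂, hx₂⟩ := h
  obtain ⟨j, hj⟩ : ∃ j, symbol (LatticeGreen.diffCoeff (Sum.inr j) c) (Sum.elim x₁ x₂) ≠ 0 := by
    by_contra! hcon
    exact fibreWeight_ne_zero_of_mem hx₁ x₂ (fibreWeight_eq_zero_iff.2 ⟨hx₂, hcon⟩)
  obtain ⟨δ, hδ, hev⟩ := exists_le_integral_poisson (j := j)
    (v := fun y => symbol c (Sum.elim x₁ y) - E)
    (v' := fun y => symbol (LatticeGreen.diffCoeff (Sum.inr j) c) (Sum.elim x₁ y)) (x₀ := x₂)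
    ((hc.continuous_symbol.comp (continuous_elim_right x₁)).sub continuous_const)
    ((hc.diffCoeff _).continuous_symbol.comp (continuous_elim_right x₁))
    (fun y => by simpa only [elim_add_single] using (hc.hasDerivAt_symbol _ _).sub_const E)
    (by simp [hx₂]) hj
  have h1 := (Complex.continuous_im.tendsto ℓ).comp hℓ
  have h2 : ℓ.im ≤ -δ := by
    refine le_of_tendsto h1 ?_
    filter_upwards [hev, self_mem_nhdsWithin] with ε h3 hε
    rw [Function.comp, hc.im_fibreGreen hε]
    exact neg_le_neg h3
  linarith

end FibreGreen

/-! ### The Fourier representation of the restricted resolvent -/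

section Fourier

variable {ι : Type} [Fintype ι]

/-- Multiplication by a continuous function on `L²` of the torus, as a continuous linear map in
both arguments. -/
def mulOp (ι : Type) [Fintype ι] : C(UnitAddTorus ι, ℂ) →L[ℂ]
    Lp ℂ 2 (torusMeasure ι) →L[ℂ] Lp ℂ 2 (torusMeasure ι) :=
  (ContinuousLinearMap.mul ℂ ℂ).holderL (torusMeasure ι) ∞ 2 2 ∘L
    ContinuousMap.toLp ∞ (torusMeasure ι) ℂ

theorem coeFn_mulOp (b : C(UnitAddTorus ι, ℂ)) (φ : Lp ℂ 2 (torusMeasure ι)) :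
    mulOp ι b φ =ᵐ[torusMeasure ι] fun x => b x * φ x := by
  have h1 := (ContinuousLinearMap.mul ℂ ℂ).coeFn_holder (r := 2)
    (ContinuousMap.toLp ∞ (torusMeasure ι) ℂ b) φ
  have h2 := ContinuousMap.coeFn_toLp (p := ∞) (𝕜 := ℂ) (torusMeasure ι) b
  filter_upwards [h1, h2] with x hx1 hx2
  rw [hx2] at hx1
  exact hx1

theorem fourierTransform_symm_apply (φ : Lp ℂ 2 (torusMeasure ι)) (n : ι → ℤ) :
    (fourierTransform ι).symm φ n = ∫ x, UnitAddTorus.mFourier (-n) x * φ x ∂torusMeasure ι :=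
  UnitAddTorus.mFourierBasis_repr φ n

theorem fourierTransform_single [DecidableEq ι] (n : ι → ℤ) :
    fourierTransform ι (lp.single 2 n 1) =
      ContinuousMap.toLp 2 (torusMeasure ι) ℂ (UnitAddTorus.mFourier n) := by
  have h := UnitAddTorus.mFourierBasis.repr_symm_single (𝕜 := ℂ) n
  rw [UnitAddTorus.coe_mFourierBasis] at h
  convert! h using 3

theorem fourierTransform_shift (n : ι → ℤ) (φ : SeqSpace ι) :
    fourierTransform ι (shift n φ) = mulOp ι (UnitAddTorus.mFourier n) (fourierTransform ι φ) := by
  rw [← LinearIsometryEquiv.eq_symm_apply]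
  ext m
  have h1 : shift n φ m = (fourierTransform ι).symm (fourierTransform ι φ) (m - n) := by
    rw [LinearIsometryEquiv.symm_apply_apply]; rfl
  rw [h1, fourierTransform_symm_apply, fourierTransform_symm_apply]
  refine integral_congr_ae ?_
  filter_upwards [coeFn_mulOp (UnitAddTorus.mFourier n) (fourierTransform ι φ)] with x hx
  rw [hx, ← mul_assoc, ← UnitAddTorus.mFourier_add, neg_sub, sub_eq_neg_add]

theorem norm_pullback_le {κ κ' : Type} (σ : (κ → ℤ) → (κ' → ℤ)) (hσ : Function.Injective σ) :
    ‖pullback σ hσ‖ ≤ 1 := by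
  unfold pullback
  exact LinearMap.mkContinuous_norm_le _ zero_le_one _

theorem ExpDecay.fourierTransform_freeHamiltonian {c : (ι → ℤ) → ℂ} (hc : ExpDecay c)
    (φ : SeqSpace ι) :
    fourierTransform ι (freeHamiltonian c φ) = mulOp ι (symbolC c) (fourierTransform ι φ) := by
  -- `freeHamiltonian` is a `tsum`, which would be `0` without summability.
  have hs : Summable fun n => c n • (shift n : SeqSpace ι →L[ℂ] SeqSpace ι) := by
    refine Summable.of_norm_bounded hc.summable_norm fun n => ?_
    rw [norm_smul]
    exact mul_le_of_le_one_right (norm_nonneg _) (norm_pullback_le _ _)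
  have h1 : HasSum (fun n => c n • shift n φ) (freeHamiltonian c φ) :=
    hs.hasSum.map (ContinuousLinearMap.apply ℂ (SeqSpace ι) φ)
      (ContinuousLinearMap.apply ℂ (SeqSpace ι) φ).continuous
  have h2 : HasSum (fun n => fourierTransform ι (c n • shift n φ))
      (fourierTransform ι (freeHamiltonian c φ)) :=
    h1.map (fourierTransform ι) (fourierTransform ι).continuous
  have h3 : HasSum (fun n => mulOp ι (c n • UnitAddTorus.mFourier n)) (mulOp ι (symbolC c)) :=
    hc.summable_symbolC.hasSum.map (mulOp ι) (mulOp ι).continuous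
  have h4 : HasSum (fun n => mulOp ι (c n • UnitAddTorus.mFourier n) (fourierTransform ι φ))
      (mulOp ι (symbolC c) (fourierTransform ι φ)) :=
    h3.map (ContinuousLinearMap.apply ℂ (Lp ℂ 2 (torusMeasure ι)) (fourierTransform ι φ))
      (ContinuousLinearMap.apply ℂ (Lp ℂ 2 (torusMeasure ι)) (fourierTransform ι φ)).continuous
  have h5 : ∀ n, mulOp ι (c n • UnitAddTorus.mFourier n) (fourierTransform ι φ) =
      fourierTransform ι (c n • shift n φ) := fun n => by
    rw [map_smul, map_smul, fourierTransform_shift]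
    rfl
  simp only [h5] at h4
  exact h2.unique h4

theorem inner_eq_integral (φ ψ : SeqSpace ι) : inner ℂ φ ψ =
    ∫ x, conj (fourierTransform ι φ x) * fourierTransform ι ψ x ∂torusMeasure ι := by
  rw [← (fourierTransform ι).inner_map_map, L2.inner_def]
  simp only [RCLike.inner_apply']

theorem isSelfAdjoint_freeHamiltonian {c : (ι → ℤ) → ℂ} (hc : ExpDecay c)
    (hh : HermitianCoeff c) : IsSelfAdjoint (freeHamiltonian c) := by
  rw [ContinuousLinearMap.isSelfAdjoint_iff_isSymmetric]
  intro φ ψ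
  change inner ℂ (freeHamiltonian c φ) ψ = inner ℂ φ (freeHamiltonian c ψ)
  rw [inner_eq_integral, inner_eq_integral, hc.fourierTransform_freeHamiltonian,
    hc.fourierTransform_freeHamiltonian]
  refine integral_congr_ae ?_
  filter_upwards [coeFn_mulOp (symbolC c) (fourierTransform ι φ),
    coeFn_mulOp (symbolC c) (fourierTransform ι ψ)] with x h1 h2
  rw [h1, h2, symbolC_eq_ofReal hc hh, map_mul, Complex.conj_ofReal]
  ring

theorem fourierTransform_resolvent {c : (ι → ℤ) → ℂ} (hc : ExpDecay c) (hh : HermitianCoeff c)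
    {z : ℂ} (hz : z.im ≠ 0) (φ : SeqSpace ι) :
    fourierTransform ι (resolvent (freeHamiltonian c) z φ) =ᵐ[torusMeasure ι]
      fun x => (z - symbol c x)⁻¹ * fourierTransform ι φ x := by
  -- `resolvent` is `Ring.inverse`, which is `0` at non-units. Self-adjointness keeps the spectrum
  -- real, so it is a true inverse here. Its symbol is then read off from `(z - H₀) ψ = φ`.
  have hz' : z ∈ resolventSet ℂ (freeHamiltonian c) := by
    by_contra hcon
    exact hz (IsSelfAdjoint.im_eq_zero_of_mem_spectrum (isSelfAdjoint_freeHamiltonian hc hh) hcon)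
  have h1 : (algebraMap ℂ _ z - freeHamiltonian c) * resolvent (freeHamiltonian c) z = 1 :=
    Ring.mul_inverse_cancel _ hz'
  set ψ := resolvent (freeHamiltonian c) z φ
  have h2 : z • ψ - freeHamiltonian c ψ = φ := by
    have := DFunLike.congr_fun h1 φ
    simpa [Algebra.algebraMap_eq_smul_one] using this
  have h3 : fourierTransform ι φ = z • fourierTransform ι ψ -
      mulOp ι (symbolC c) (fourierTransform ι ψ) := by
    rw [← h2, map_sub, map_smul, hc.fourierTransform_freeHamiltonian]
  rw [h3]
  filter_upwards [Lp.coeFn_sub (z • fourierTransform ι ψ)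
    (mulOp ι (symbolC c) (fourierTransform ι ψ)), Lp.coeFn_smul z (fourierTransform ι ψ),
    coeFn_mulOp (symbolC c) (fourierTransform ι ψ)] with x e1 e2 e3
  have hne : z - symbol c x ≠ 0 := fun h => hz (by simpa using congrArg Complex.im h)
  rw [e1, Pi.sub_apply, e2, e3, Pi.smul_apply, smul_eq_mul, symbolC_eq_ofReal hc hh]
  field_simp

theorem continuousLinearMap_ext_single [DecidableEq ι] {F : Type*} [NormedAddCommGroup F]
    [NormedSpace ℂ F] {A B : SeqSpace ι →L[ℂ] F}
    (h : ∀ n, A (lp.single 2 n 1) = B (lp.single 2 n 1)) : A = B := by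
  ext φ
  have hφ := lp.hasSum_single (by simp) φ
  refine (A.hasSum hφ).unique ?_
  convert! B.hasSum hφ using 2 with n
  have : lp.single 2 n (φ n) = φ n • (lp.single 2 n 1 : SeqSpace ι) := by
    rw [← lp.single_smul, smul_eq_mul, mul_one]
  simp only [this, map_smul, h]

end Fourier

/-! ### Restriction to the surface in the Fourier representation. -/

section Surface

variable {d₁ d₂ : ℕ}

theorem measurePreserving_elim (ι κ : Type) [Fintype ι] [Fintype κ] :
    MeasurePreserving (fun p : UnitAddTorus ι × UnitAddTorus κ =>
      (Sum.elim p.1 p.2 : UnitAddTorus (ι ⊕ κ)))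
      ((torusMeasure ι).prod (torusMeasure κ)) (torusMeasure (ι ⊕ κ)) := by
  have := (measurePreserving_sumPiEquivProdPi_symm
    (fun _ : ι ⊕ κ => (AddCircle.haarAddCircle : Measure UnitAddCircle)))
  convert! this using 1

theorem measurePreserving_inl (ι κ : Type) [Fintype ι] [Fintype κ] :
    MeasurePreserving (fun (x : UnitAddTorus (ι ⊕ κ)) i => x (Sum.inl i))
      (torusMeasure (ι ⊕ κ)) (torusMeasure ι) :=
  measurePreserving_fst.comp (measurePreserving_sumPiEquivProdPi
    (fun _ : ι ⊕ κ => (AddCircle.haarAddCircle : Measure UnitAddCircle)))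

theorem adjoint_surfaceProj_single (n : Fin d₁ → ℤ) :
    ContinuousLinearMap.adjoint (surfaceProj d₁ d₂) (lp.single 2 n 1) =
      lp.single 2 (surfaceIncl d₁ d₂ n) 1 := by
  refine ext_inner_left ℂ fun φ => ?_
  rw [ContinuousLinearMap.adjoint_inner_right, lp.inner_single_right, lp.inner_single_right]
  rfl

/-- Extension by zero off `Λ` yields a Fourier series without `k₂`. Both sides are continuous in
`v`, so the basis vectors suffice. -/
theorem fourierTransform_adjoint_surfaceProj (v : SeqSpace (Fin d₁)) :
    fourierTransform (Fin d₁ ⊕ Fin d₂) (ContinuousLinearMap.adjoint (surfaceProj d₁ d₂) v)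
      =ᵐ[torusMeasure (Fin d₁ ⊕ Fin d₂)] fun x => fourierTransform (Fin d₁) v fun i => x (Sum.inl i) := by
  set W := Lp.compMeasurePreservingₗᵢ ℂ (E := ℂ) (p := 2) _ (measurePreserving_inl (Fin d₁) (Fin d₂))
  have h : (fourierTransform (Fin d₁ ⊕ Fin d₂)).toContinuousLinearEquiv.toContinuousLinearMap ∘L
      ContinuousLinearMap.adjoint (surfaceProj d₁ d₂) = W.toContinuousLinearMap ∘L
      (fourierTransform (Fin d₁)).toContinuousLinearEquiv.toContinuousLinearMap := by
    refine continuousLinearMap_ext_single fun n => ?_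
    change fourierTransform (Fin d₁ ⊕ Fin d₂)
      (ContinuousLinearMap.adjoint (surfaceProj d₁ d₂) (lp.single 2 n 1)) =
      W (fourierTransform (Fin d₁) (lp.single 2 n 1))
    rw [adjoint_surfaceProj_single, fourierTransform_single, fourierTransform_single]
    refine Lp.ext ?_
    have h1 := ContinuousMap.coeFn_toLp (p := 2) (𝕜 := ℂ) (torusMeasure (Fin d₁ ⊕ Fin d₂))
      (UnitAddTorus.mFourier (surfaceIncl d₁ d₂ n))
    have h2 := Lp.coeFn_compMeasurePreserving
      (ContinuousMap.toLp 2 (torusMeasure (Fin d₁)) ℂ (UnitAddTorus.mFourier n))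
      (measurePreserving_inl (Fin d₁) (Fin d₂))
    have h3 := (measurePreserving_inl (Fin d₁) (Fin d₂)).quasiMeasurePreserving.ae_eq_comp
      (ContinuousMap.coeFn_toLp (p := 2) (𝕜 := ℂ) (torusMeasure (Fin d₁)) (UnitAddTorus.mFourier n))
    refine h1.trans (EventuallyEq.trans ?_ (h2.trans h3).symm)
    refine Eventually.of_forall fun x => ?_
    simp [UnitAddTorus.mFourier, surfaceIncl, Fintype.prod_sum_type]
  have h' := DFunLike.congr_fun h v
  change fourierTransform (Fin d₁ ⊕ Fin d₂) (ContinuousLinearMap.adjoint (surfaceProj d₁ d₂) v) =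
    W (fourierTransform _ v) at h'
  rw [h']
  exact Lp.coeFn_compMeasurePreserving _ (measurePreserving_inl (Fin d₁) (Fin d₂))

/-- The transforms of `Π* u` and `Π* v` are constant along the fibres, so by Fubini only the
resolvent factor is integrated over `k₂`. -/
theorem inner_greenRestricted {c : (Fin d₁ ⊕ Fin d₂ → ℤ) → ℂ} (hc : ExpDecay c)
    (hh : HermitianCoeff c) {z : ℂ} (hz : z.im ≠ 0) (u v : SeqSpace (Fin d₁)) :
    inner ℂ u (greenRestricted c z v) =
      ∫ x, conj (fourierTransform (Fin d₁) u x) * (fibreGreen c z x * fourierTransform (Fin d₁) v x)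
        ∂torusMeasure (Fin d₁) := by
  set û := fourierTransform (Fin d₁) u
  set vh := fourierTransform (Fin d₁) v
  set p : UnitAddTorus (Fin d₁ ⊕ Fin d₂) → UnitAddTorus (Fin d₁) := fun x i => x (Sum.inl i)
  have h1 : inner ℂ u (greenRestricted c z v) = ∫ x, conj (û (p x)) *
      ((z - symbol c x)⁻¹ * vh (p x)) ∂torusMeasure (Fin d₁ ⊕ Fin d₂) := by
    simp only [greenRestricted, ContinuousLinearMap.comp_apply]
    rw [← ContinuousLinearMap.adjoint_inner_left, inner_eq_integral]
    refine integral_congr_ae ?_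
    filter_upwards [fourierTransform_adjoint_surfaceProj (d₂ := d₂) u,
      fourierTransform_adjoint_surfaceProj (d₂ := d₂) v,
      fourierTransform_resolvent hc hh hz (ContinuousLinearMap.adjoint (surfaceProj d₁ d₂) v)]
      with x e1 e2 e3
    rw [e1, e3, e2]
  have hemb : MeasurePreserving (fun q : UnitAddTorus (Fin d₁) × UnitAddTorus (Fin d₂) =>
      (Sum.elim q.1 q.2 : UnitAddTorus (Fin d₁ ⊕ Fin d₂))) _ _ :=
    measurePreserving_elim (Fin d₁) (Fin d₂)
  have hint0 : Integrable (fun x => conj (û x) * vh x) (torusMeasure (Fin d₁)) := by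
    have := L2.integrable_inner (𝕜 := ℂ) û vh
    simpa only [RCLike.inner_apply'] using this
  have hr := hc.continuous_resolvent_fibre hz
  obtain ⟨C, hC⟩ := (isCompact_range hr).isBounded.exists_norm_le
  have hint : Integrable (fun x => conj (û (p x)) * ((z - symbol c x)⁻¹ * vh (p x)))
      (torusMeasure (Fin d₁ ⊕ Fin d₂)) := by
    have h2 := ((measurePreserving_inl (Fin d₁) (Fin d₂)).integrable_comp_of_integrable hint0)
    have h3 := h2.bdd_mul (c := C) hr.aestronglyMeasurable (ae_of_all _ fun x => hC _ ⟨x, rfl⟩)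
    refine h3.congr (ae_of_all _ fun x => ?_)
    simp only [Function.comp]
    ring
  rw [h1, ← hemb.map_eq, integral_map hemb.measurable.aemeasurable
    (by rw [hemb.map_eq]; exact hint.aestronglyMeasurable), integral_prod _ (by
      have := hemb.integrable_comp_of_integrable hint
      exact this)]
  refine integral_congr_ae (ae_of_all _ fun x₁ => ?_)
  have h4 : ∀ x₂ : UnitAddTorus (Fin d₂), p (Sum.elim x₁ x₂) = x₁ := fun x₂ => rfl
  simp only [h4]
  rw [integral_const_mul, integral_mul_const]
  rfl

end Surface

/-! ### Multiplication operators -/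

section Multiplication

variable {X : Type*} [MeasurableSpace X] {μ : Measure X}

/-- Multiplication by an essentially bounded function on `L²`. -/
def bddMul {b : X → ℂ} (hb : MemLp b ∞ μ) : Lp ℂ 2 μ →L[ℂ] Lp ℂ 2 μ :=
  (ContinuousLinearMap.mul ℂ ℂ).holderL μ ∞ 2 2 (hb.toLp b)

theorem coeFn_bddMul {b : X → ℂ} (hb : MemLp b ∞ μ) (φ : Lp ℂ 2 μ) :
    bddMul hb φ =ᵐ[μ] fun x => b x * φ x := by
  have h1 := (ContinuousLinearMap.mul ℂ ℂ).coeFn_holder (r := 2) (hb.toLp b) φ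
  filter_upwards [h1, hb.coeFn_toLp] with x hx1 hx2
  rw [hx2] at hx1
  exact hx1

theorem memLp_top_indicator {b : X → ℂ} (hb : Measurable b) {S : Set X} (hS : MeasurableSet S)
    {M : ℝ} (hM : ∀ᵐ x ∂μ, x ∈ S → ‖b x‖ ≤ M) : MemLp (S.indicator b) ∞ μ := by
  refine memLp_top_of_bound (hb.indicator hS).aestronglyMeasurable |M| ?_
  filter_upwards [hM] with x hx
  by_cases h : x ∈ S
  · rw [Set.indicator_of_mem h]
    exact (hx h).trans (le_abs_self M)
  · rw [Set.indicator_of_notMem h, norm_zero]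
    positivity

theorem memLp_top_indicator_one {S : Set X} (hS : MeasurableSet S) :
    MemLp (S.indicator fun _ => (1 : ℂ)) ∞ μ :=
  memLp_top_indicator measurable_const hS (M := 1) (by simp)

/-- The restriction of an `L²` function to a measurable set. -/
def cutoff {S : Set X} (hS : MeasurableSet S) : Lp ℂ 2 μ →L[ℂ] Lp ℂ 2 μ :=
  bddMul (memLp_top_indicator_one hS)

theorem coeFn_cutoff {S : Set X} (hS : MeasurableSet S) (φ : Lp ℂ 2 μ) :
    cutoff hS φ =ᵐ[μ] S.indicator φ := by
  filter_upwards [coeFn_bddMul (memLp_top_indicator_one hS) φ] with x hx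
  rw [cutoff, hx]
  by_cases h : x ∈ S <;> simp [h]

theorem integrable_conj_mul (χ φ : Lp ℂ 2 μ) : Integrable (fun x => conj (χ x) * φ x) μ := by
  simpa only [RCLike.inner_apply'] using L2.integrable_inner (𝕜 := ℂ) χ φ

theorem L2_inner_eq (χ φ : Lp ℂ 2 μ) : inner ℂ χ φ = ∫ x, conj (χ x) * φ x ∂μ := by
  simp only [L2.inner_def, RCLike.inner_apply']

/-- The squared norm of the difference is the integral of `|φ|²` over the complement of `R n`, and
dominated convergence applies. -/
theorem tendsto_cutoff {R : ℕ → Set X} (hR : ∀ n, MeasurableSet (R n))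
    (hae : ∀ᵐ x ∂μ, ∀ᶠ n in atTop, x ∈ R n) (φ : Lp ℂ 2 μ) :
    Tendsto (fun n => cutoff (hR n) φ) atTop (𝓝 φ) := by
  rw [tendsto_iff_norm_sub_tendsto_zero]
  have h1 : Tendsto (fun n => inner ℂ (cutoff (hR n) φ - φ) (cutoff (hR n) φ - φ)) atTop
      (𝓝 (∫ _, (0 : ℂ) ∂μ)) := by
    have h2 : ∀ n, inner ℂ (cutoff (hR n) φ - φ) (cutoff (hR n) φ - φ) =
        ∫ x, (R n)ᶜ.indicator (fun x => conj (φ x) * φ x) x ∂μ := fun n => by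
      rw [L2_inner_eq]
      refine integral_congr_ae ?_
      filter_upwards [coeFn_cutoff (hR n) φ, Lp.coeFn_sub (cutoff (hR n) φ) φ] with x e1 e2
      rw [e2, Pi.sub_apply, e1]
      by_cases h : x ∈ R n <;> simp [h]
    simp_rw [h2]
    refine tendsto_integral_of_dominated_convergence (fun x => ‖conj (φ x) * φ x‖)
      (fun n => ((integrable_conj_mul φ φ).indicator (hR n).compl).aestronglyMeasurable)
      (integrable_conj_mul φ φ).norm (fun n => ae_of_all _ fun x => norm_indicator_le_norm_self _ _) ?_
    filter_upwards [hae] with x hx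
    refine tendsto_const_nhds.congr' ?_
    filter_upwards [hx] with n hn
    simp [hn]
  have h3 := ((Real.continuous_sqrt.comp Complex.continuous_re).tendsto _).comp h1
  simp only [integral_zero, Function.comp_apply, Complex.zero_re, Real.sqrt_zero] at h3
  refine h3.congr fun n => ?_
  rw [norm_eq_sqrt_re_inner (𝕜 := ℂ)]
  rfl

theorem eq_zero_of_integral_conj_mul_self {ψ : Lp ℂ 2 μ}
    (h : ∫ x, conj (ψ x) * ψ x ∂μ = 0) : ψ = 0 := by
  rw [← inner_self_eq_zero (𝕜 := ℂ), L2_inner_eq, h]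

variable {H : Type*} [NormedAddCommGroup H] [InnerProductSpace ℂ H]
  (U : H ≃ₗᵢ[ℂ] Lp ℂ 2 μ) {R : ℕ → Set X}

/-! ### Weak limits of multiplication operators. -/

section Boundary

variable {A : ℝ → H →L[ℂ] H} {g : ℝ → X → ℂ} {g₀ : X → ℂ}

/-- Dominated convergence for the matrix elements of multiplication operators with functions that
converge boundedly on `S`. -/
theorem tendsto_integral_conj_mul (hg : ∀ ε, 0 < ε → Measurable (g ε)) {S : Set X} {M : ℝ}
    (hM : ∀ x ∈ S, ∀ ε, 0 < ε → ε ≤ 1 → ‖g ε x‖ ≤ M)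
    (hlim : ∀ᵐ x ∂μ, Tendsto (fun ε => g ε x) (𝓝[>] 0) (𝓝 (g₀ x))) {χ φ : Lp ℂ 2 μ}
    (h0 : ∀ᵐ x ∂μ, x ∉ S → χ x = 0 ∨ φ x = 0) :
    Tendsto (fun ε => ∫ x, conj (χ x) * (g ε x * φ x) ∂μ) (𝓝[>] 0)
      (𝓝 (∫ x, conj (χ x) * (g₀ x * φ x) ∂μ)) := by
  refine tendsto_integral_filter_of_dominated_convergence
    (fun x => |M| * ‖conj (χ x) * φ x‖) ?_ ?_ ((integrable_conj_mul χ φ).norm.const_mul _) ?_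
  · filter_upwards [self_mem_nhdsWithin] with ε hε
    have h1 : AEStronglyMeasurable (fun x => conj (χ x)) μ :=
      Complex.continuous_conj.comp_aestronglyMeasurable (Lp.aestronglyMeasurable χ)
    exact h1.mul ((hg ε hε).aestronglyMeasurable.mul (Lp.aestronglyMeasurable φ))
  · filter_upwards [Ioc_mem_nhdsGT zero_lt_one] with ε hε
    filter_upwards [h0] with x hx
    by_cases hxS : x ∈ S
    · rw [mul_left_comm, norm_mul]
      gcongr
      exact (hM x hxS ε hε.1 hε.2).trans (le_abs_self M)
    · rcases hx hxS with h | h <;> simp [h]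
  · filter_upwards [hlim] with x hx
    exact (hx.mul_const _).const_mul _

/-- The elements of the graph of a weak limit of multiplication operators are related by
multiplication with the pointwise limit. -/
theorem eq_mul_of_mem_weakLimitGraph
    (hA : ∀ ε, 0 < ε → ∀ u v, inner ℂ u (A ε v) = ∫ x, conj (U u x) * (g ε x * U v x) ∂μ)
    (hg : ∀ ε, 0 < ε → Measurable (g ε)) (hR : ∀ n, MeasurableSet (R n))
    (hae : ∀ᵐ x ∂μ, ∀ᶠ n in atTop, x ∈ R n)
    (hM : ∀ n, ∃ M, ∀ x ∈ R n, ∀ ε, 0 < ε → ε ≤ 1 → ‖g ε x‖ ≤ M)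
    (hg₀ : Measurable g₀) (hlim : ∀ᵐ x ∂μ, Tendsto (fun ε => g ε x) (𝓝[>] 0) (𝓝 (g₀ x)))
    {v w : H} (h : (v, w) ∈ weakLimitGraph A) : U w =ᵐ[μ] fun x => g₀ x * U v x := by
  have hn : ∀ n, ∀ᵐ x ∂μ, x ∈ R n → U w x = g₀ x * U v x := by
    intro n
    obtain ⟨M, hM⟩ := hM n
    have hM₀ : ∀ᵐ x ∂μ, x ∈ R n → ‖g₀ x‖ ≤ M := by
      filter_upwards [hlim] with x hx hxR
      refine le_of_tendsto hx.norm ?_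
      filter_upwards [Ioc_mem_nhdsGT zero_lt_one] with ε hε using hM x hxR ε hε.1 hε.2
    -- The part over `R n` of the difference to be shown zero serves as its own test vector. Its
    -- support in `R n` justifies dominated convergence for arbitrary `v`, and equality of the two
    -- limits says that its norm is `0`.
    set ψ := cutoff (hR n) (U w) - bddMul (memLp_top_indicator hg₀ (hR n) hM₀) (U v)
    have hψ : ∀ᵐ x ∂μ, ψ x = (R n).indicator (fun x => U w x - g₀ x * U v x) x := by
      filter_upwards [Lp.coeFn_sub (cutoff (hR n) (U w))
        (bddMul (memLp_top_indicator hg₀ (hR n) hM₀) (U v)), coeFn_cutoff (hR n) (U w),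
        coeFn_bddMul (memLp_top_indicator hg₀ (hR n) hM₀) (U v)] with x e1 e2 e3
      rw [e1, Pi.sub_apply, e2, e3]
      by_cases hx : x ∈ R n <;> simp [hx]
    have h0 : ∀ᵐ x ∂μ, x ∉ R n → ψ x = 0 ∨ U v x = 0 := by
      filter_upwards [hψ] with x hx hxR
      left
      rw [hx, Set.indicator_of_notMem hxR]
    have t1 := tendsto_integral_conj_mul hg hM hlim h0
    have t2 : Tendsto (fun ε => ∫ x, conj (ψ x) * (g ε x * U v x) ∂μ) (𝓝[>] 0)
        (𝓝 (∫ x, conj (ψ x) * U w x ∂μ)) := by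
      have := h (U.symm ψ)
      rw [← U.inner_map_map, U.apply_symm_apply, L2_inner_eq] at this
      refine this.congr' ?_
      filter_upwards [self_mem_nhdsWithin] with ε hε
      rw [hA ε hε, U.apply_symm_apply]
    have e := tendsto_nhds_unique t2 t1
    have hψ0 : ψ = 0 := by
      refine eq_zero_of_integral_conj_mul_self ?_
      have hint2 : Integrable (fun x => conj (ψ x) * (g₀ x * U v x)) μ := by
        refine (integrable_conj_mul ψ (bddMul (memLp_top_indicator hg₀ (hR n) hM₀) (U v))).congr ?_
        filter_upwards [hψ, coeFn_bddMul (memLp_top_indicator hg₀ (hR n) hM₀) (U v)] with x e1 e2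
        by_cases hx : x ∈ R n <;> simp [hx, e1, e2]
      rw [← sub_eq_zero.2 e, ← integral_sub (integrable_conj_mul ψ (U w)) hint2]
      refine integral_congr_ae ?_
      filter_upwards [hψ] with x e1
      by_cases hx : x ∈ R n
      · simp [hx, e1]; ring
      · simp [hx, e1]
    filter_upwards [hψ, (hψ0 ▸ Lp.coeFn_zero ℂ 2 μ : ψ =ᵐ[μ] 0)] with x e1 e2 hx
    rw [e2, Set.indicator_of_mem hx] at e1
    exact (sub_eq_zero.1 e1.symm)
  filter_upwards [ae_all_iff.2 hn, hae] with x h1 h2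
  obtain ⟨n, hn⟩ := h2.exists
  exact h1 n hn

/-- Since `U v` lives on `S`, the uniform bound on `S` dominates the matrix elements for every test
vector `u`. -/
theorem mem_weakLimitGraph_of_eq_mul
    (hA : ∀ ε, 0 < ε → ∀ u v, inner ℂ u (A ε v) = ∫ x, conj (U u x) * (g ε x * U v x) ∂μ)
    (hg : ∀ ε, 0 < ε → Measurable (g ε)) {S : Set X} {M : ℝ}
    (hM : ∀ x ∈ S, ∀ ε, 0 < ε → ε ≤ 1 → ‖g ε x‖ ≤ M)
    (hlim : ∀ᵐ x ∂μ, Tendsto (fun ε => g ε x) (𝓝[>] 0) (𝓝 (g₀ x)))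
    {v w : H} (hv : ∀ᵐ x ∂μ, x ∉ S → U v x = 0) (hw : U w =ᵐ[μ] fun x => g₀ x * U v x) :
    (v, w) ∈ weakLimitGraph A := by
  intro u
  have t1 := tendsto_integral_conj_mul (χ := U u) (φ := U v) hg hM hlim
    (by filter_upwards [hv] with x hx hxS using Or.inr (hx hxS))
  have e : inner ℂ u w = ∫ x, conj (U u x) * (g₀ x * U v x) ∂μ := by
    rw [← U.inner_map_map, L2_inner_eq]
    refine integral_congr_ae ?_
    filter_upwards [hw] with x hx
    rw [hx]
  rw [e]
  refine t1.congr' ?_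
  filter_upwards [self_mem_nhdsWithin] with ε hε
  rw [hA ε hε]

end Boundary

/-! ### Maximal multiplication operators. -/

section MulGraph

variable {h : X → ℂ}

/-- The graph of the maximal operator of multiplication by `h`. -/
def mulGraph (h : X → ℂ) : Submodule ℂ (H × H) where
  carrier := {p | U p.2 =ᵐ[μ] fun x => h x * U p.1 x}
  add_mem' := fun {p q} hp hq => by
    change U (p.2 + q.2) =ᵐ[μ] fun x => h x * U (p.1 + q.1) x
    rw [map_add, map_add]
    filter_upwards [hp, hq, Lp.coeFn_add (U p.2) (U q.2), Lp.coeFn_add (U p.1) (U q.1)]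
      with x e1 e2 e3 e4
    rw [e3, e4, Pi.add_apply, Pi.add_apply, e1, e2, mul_add]
  zero_mem' := by
    change U 0 =ᵐ[μ] fun x => h x * U 0 x
    rw [map_zero]
    filter_upwards [Lp.coeFn_zero ℂ 2 μ] with x e
    simp only [e, Pi.zero_apply, mul_zero]
  smul_mem' := fun a p hp => by
    change U (a • p.2) =ᵐ[μ] fun x => h x * U (a • p.1) x
    rw [map_smul, map_smul]
    filter_upwards [hp, Lp.coeFn_smul a (U p.2), Lp.coeFn_smul a (U p.1)] with x e1 e2 e3
    rw [e2, e3, Pi.smul_apply, Pi.smul_apply, e1, smul_eq_mul, smul_eq_mul]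
    ring

theorem mem_mulGraph {v w : H} : (v, w) ∈ mulGraph U h ↔ U w =ᵐ[μ] fun x => h x * U v x := Iff.rfl

variable (hh : Measurable h) (hR : ∀ n, MeasurableSet (R n))
  (hM : ∀ n, ∃ M : ℝ, ∀ᵐ x ∂μ, x ∈ R n → ‖h x‖ ≤ M) (hae : ∀ᵐ x ∂μ, ∀ᶠ n in atTop, x ∈ R n)

include hh hR hM hae

/-- The relation holds almost everywhere exactly when it holds on each `R n`. There the multiplier
is bounded, so the relation is an equation between continuous maps. -/
theorem isClosed_mulGraph : IsClosed (mulGraph U h : Set (H × H)) := by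
  choose M hM using hM
  have : (mulGraph U h : Set (H × H)) = ⋂ n, {p | cutoff (hR n) (U p.2) =
      bddMul (memLp_top_indicator hh (hR n) (hM n)) (U p.1)} := by
    ext ⟨v, w⟩
    simp only [Set.mem_iInter]
    constructor
    · intro hp n
      refine Lp.ext ?_
      filter_upwards [coeFn_cutoff (hR n) (U w), coeFn_bddMul
        (memLp_top_indicator hh (hR n) (hM n)) (U v), (mem_mulGraph U).1 hp] with x e1 e2 e3
      rw [e1, e2]
      by_cases hx : x ∈ R n <;> simp [hx, e3]
    · intro hp
      refine (mem_mulGraph U).2 ?_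
      have e1 := ae_all_iff.2 fun n => coeFn_cutoff (hR n) (U w)
      have e2 := ae_all_iff.2 fun n => coeFn_bddMul (memLp_top_indicator hh (hR n) (hM n)) (U v)
      filter_upwards [e1, e2, hae] with x e1 e2 hx
      obtain ⟨n, hn⟩ := hx.exists
      have e1 := e1 n
      have e2 := e2 n
      have hpn : cutoff (hR n) (U w) = bddMul (memLp_top_indicator hh (hR n) (hM n)) (U v) := hp n
      rw [hpn, e2] at e1
      simpa [hn] using e1.symm
  rw [this]
  refine isClosed_iInter fun n => isClosed_eq ?_ ?_
  · exact (cutoff (hR n)).continuous.comp (U.continuous.comp continuous_snd)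
  · exact (bddMul _).continuous.comp (U.continuous.comp continuous_fst)

omit hh hM hae in
theorem cutoff_mem_mulGraph {v w : H} (hvw : (v, w) ∈ mulGraph U h) (n : ℕ) :
    (U.symm (cutoff (hR n) (U v)), U.symm (cutoff (hR n) (U w))) ∈ mulGraph U h := by
  rw [mem_mulGraph, U.apply_symm_apply, U.apply_symm_apply]
  filter_upwards [coeFn_cutoff (hR n) (U v), coeFn_cutoff (hR n) (U w), (mem_mulGraph U).1 hvw]
    with x e1 e2 e3
  rw [e1, e2]
  by_cases hx : x ∈ R n <;> simp [hx, e3]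

omit hh hM in
/-- The part of the graph over functions supported in one of the sets `R n` is dense. -/
theorem mulGraph_le_topologicalClosure {G : Submodule ℂ (H × H)}
    (hG : ∀ v w n, (v, w) ∈ mulGraph U h → (∀ᵐ x ∂μ, x ∉ R n → U v x = 0) → (v, w) ∈ G) :
    mulGraph U h ≤ G.topologicalClosure := by
  rintro ⟨v, w⟩ hvw
  have ht : ∀ φ : H, Tendsto (fun n => U.symm (cutoff (hR n) (U φ))) atTop (𝓝 φ) := fun φ => by
    simpa [Function.comp_def] using (U.symm.continuous.tendsto _).comp (tendsto_cutoff hR hae (U φ))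
  refine mem_closure_of_tendsto ((ht v).prodMk_nhds (ht w)) (Eventually.of_forall fun n => ?_)
  refine hG _ _ n (cutoff_mem_mulGraph U hR hvw n) ?_
  rw [U.apply_symm_apply]
  filter_upwards [coeFn_cutoff (hR n) (U v)] with x e hx
  rw [e, Set.indicator_of_notMem hx]

/-- Maximal multiplication operators by real functions are self-adjoint. -/
theorem isSelfAdjoint_of_graph_eq [CompleteSpace H] (hreal : ∀ᵐ x ∂μ, conj (h x) = h x)
    {T : H →ₗ.[ℂ] H} (hT : T.graph = mulGraph U h) : IsSelfAdjoint T := by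
  choose M hM using hM
  have hmem : ∀ n (φ : Lp ℂ 2 μ), (U.symm (cutoff (hR n) φ),
      U.symm (bddMul (memLp_top_indicator hh (hR n) (hM n)) φ)) ∈ mulGraph U h := by
    intro n φ
    rw [mem_mulGraph, U.apply_symm_apply, U.apply_symm_apply]
    filter_upwards [coeFn_cutoff (hR n) φ, coeFn_bddMul
      (memLp_top_indicator hh (hR n) (hM n)) φ] with x e1 e2
    rw [e1, e2]
    by_cases hx : x ∈ R n <;> simp [hx]
  have hdense : Dense (T.domain : Set H) := by
    intro φ
    have ht : Tendsto (fun n => U.symm (cutoff (hR n) (U φ))) atTop (𝓝 φ) := by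
      simpa [Function.comp_def] using (U.symm.continuous.tendsto _).comp (tendsto_cutoff hR hae (U φ))
    refine mem_closure_of_tendsto ht (Eventually.of_forall fun n => ?_)
    exact LinearPMap.mem_domain_iff.2 ⟨_, hT ▸ hmem n (U φ)⟩
  rw [LinearPMap.isSelfAdjoint_def]
  refine LinearPMap.eq_of_eq_graph ?_
  rw [LinearPMap.adjoint_graph_eq_graph_adjoint hdense, hT]
  ext ⟨a, b⟩
  rw [Submodule.mem_adjoint_iff, mem_mulGraph]
  constructor
  · intro hab
    have hn : ∀ n, ∀ᵐ x ∂μ, x ∈ R n → U b x = h x * U a x := by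
      intro n
      set B := bddMul (memLp_top_indicator hh (hR n) (hM n))
      -- The adjoint relation, tested against the pair formed by the cutoffs of `ψ` and `h ψ`, gives
      -- `‖ψ‖² = 0` because `h` is real.
      set ψ := cutoff (hR n) (U b) - B (U a)
      have hψ : ∀ᵐ x ∂μ, ψ x = (R n).indicator (fun x => U b x - h x * U a x) x := by
        filter_upwards [Lp.coeFn_sub (cutoff (hR n) (U b)) (B (U a)), coeFn_cutoff (hR n) (U b),
          coeFn_bddMul (memLp_top_indicator hh (hR n) (hM n)) (U a)] with x e1 e2 e3
        rw [e1, Pi.sub_apply, e2, e3]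
        by_cases hx : x ∈ R n <;> simp [hx]
      have h1 := hab _ _ (hmem n ψ)
      rw [← U.inner_map_map, ← U.inner_map_map, U.apply_symm_apply, U.apply_symm_apply, L2_inner_eq,
        L2_inner_eq, ← integral_sub (integrable_conj_mul _ _) (integrable_conj_mul _ _)] at h1
      have hψ0 : ψ = 0 := by
        refine eq_zero_of_integral_conj_mul_self ?_
        rw [← neg_eq_zero, ← h1, ← integral_neg]
        refine integral_congr_ae ?_
        filter_upwards [hψ, coeFn_cutoff (hR n) ψ, coeFn_bddMul
          (memLp_top_indicator hh (hR n) (hM n)) ψ, hreal] with x e1 e2 e3 e4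
        rw [e2, e3]
        by_cases hx : x ∈ R n
        · simp only [Set.indicator_of_mem hx, map_mul, e4]
          rw [e1, Set.indicator_of_mem hx]
          ring
        · simp [hx, e1]
      filter_upwards [hψ, (hψ0 ▸ Lp.coeFn_zero ℂ 2 μ : ψ =ᵐ[μ] 0)] with x e1 e2 hx
      rw [e2, Set.indicator_of_mem hx] at e1
      exact (sub_eq_zero.1 e1.symm)
    filter_upwards [ae_all_iff.2 hn, hae] with x h1 h2
    obtain ⟨n, hn⟩ := h2.exists
    exact h1 n hn
  · intro hab v w hvw
    rw [sub_eq_zero, ← U.inner_map_map, ← U.inner_map_map, L2_inner_eq, L2_inner_eq]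
    refine integral_congr_ae ?_
    filter_upwards [hab, (mem_mulGraph U).1 hvw, hreal] with x e1 e2 e3
    simp only [e1, e2, map_mul, e3]
    ring

end MulGraph

/-- The orthogonal complement of the range of a self-adjoint operator is its kernel. -/
theorem orthogonal_closedRange [CompleteSpace H] {T : H →ₗ.[ℂ] H} (hT : IsSelfAdjoint T) :
    (closedRange T)ᗮ = kernel T := by
  rw [closedRange, Submodule.orthogonal_closure]
  ext v
  have h1 : v ∈ kernel T ↔ (v, (0 : H)) ∈ T.graph.adjoint := by
    rw [← LinearPMap.adjoint_graph_eq_graph_adjoint hT.dense_domain,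
      LinearPMap.isSelfAdjoint_def.1 hT]
    rfl
  rw [h1, Submodule.mem_adjoint_iff, Submodule.mem_orthogonal]
  simp only [inner_zero_right, sub_zero]
  constructor
  · intro h a b hab
    obtain ⟨y, -, hy⟩ := (LinearPMap.mem_graph_iff T).1 hab
    exact h b ⟨y, hy⟩
  · rintro h _ ⟨y, rfl⟩
    exact h y _ (T.mem_graph y)

end Multiplication

/-! ### The closed imaginary part of the weak limits. -/

section ImaginaryPart

variable {X : Type*} [MeasurableSpace X] {μ : Measure X}
  {H : Type*} [NormedAddCommGroup H] [InnerProductSpace ℂ H]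

theorem mem_graph_smul_sub {a : ℂ} {S T : H →ₗ.[ℂ] H} {v w : H} :
    (v, w) ∈ (a • (S - T)).graph ↔
      ∃ s t, (v, s) ∈ S.graph ∧ (v, t) ∈ T.graph ∧ a • (s - t) = w := by
  simp only [LinearPMap.mem_graph_iff]
  constructor
  · rintro ⟨y, rfl, rfl⟩
    exact ⟨_, _, ⟨⟨y, y.2.1⟩, rfl, rfl⟩, ⟨⟨y, y.2.2⟩, rfl, rfl⟩, rfl⟩
  · rintro ⟨s, t, ⟨y, rfl, rfl⟩, ⟨y', h, rfl⟩, rfl⟩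
    refine ⟨⟨y, y.2, h ▸ y'.2⟩, rfl, ?_⟩
    exact congrArg (fun q => a • (S y - T q)) (Subtype.ext h.symm)

variable (U : H ≃ₗᵢ[ℂ] Lp ℂ 2 μ) {R : ℕ → Set X} {A B : ℝ → H →L[ℂ] H} {g : ℝ → X → ℂ}
  {g₀ : X → ℂ}

/-- The closure of the imaginary part of the weak limits of multiplication operators is the maximal
multiplication operator by the imaginary part of the pointwise limit. -/
theorem graph_closure_imaginaryPart
    (hA : ∀ ε, 0 < ε → ∀ u v, inner ℂ u (A ε v) = ∫ x, conj (U u x) * (g ε x * U v x) ∂μ)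
    (hB : ∀ ε, 0 < ε → ∀ u v, inner ℂ u (B ε v) = ∫ x, conj (U u x) * (conj (g ε x) * U v x) ∂μ)
    (hg : ∀ ε, 0 < ε → Measurable (g ε)) (hR : ∀ n, MeasurableSet (R n))
    (hae : ∀ᵐ x ∂μ, ∀ᶠ n in atTop, x ∈ R n)
    (hM : ∀ n, ∃ M, ∀ x ∈ R n, ∀ ε, 0 < ε → ε ≤ 1 → ‖g ε x‖ ≤ M)
    (hg₀ : Measurable g₀) (hlim : ∀ᵐ x ∂μ, Tendsto (fun ε => g ε x) (𝓝[>] 0) (𝓝 (g₀ x)))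
    (hM₀ : ∀ n, ∃ M : ℝ, ∀ᵐ x ∂μ, x ∈ R n → ‖g₀ x‖ ≤ M) :
    ((1 / (2 * Complex.I) : ℂ) • (weakLimit B - weakLimit A)).closure.graph =
      mulGraph U fun x => ((-(g₀ x).im : ℝ) : ℂ) := by
  have hcg : ∀ ε, 0 < ε → Measurable fun x => conj (g ε x) := fun ε hε =>
    Complex.continuous_conj.measurable.comp (hg ε hε)
  have hcg₀ : Measurable fun x => conj (g₀ x) := Complex.continuous_conj.measurable.comp hg₀
  have hcM : ∀ n, ∃ M, ∀ x ∈ R n, ∀ ε, 0 < ε → ε ≤ 1 → ‖conj (g ε x)‖ ≤ M := by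
    simpa only [RCLike.norm_conj] using hM
  have hclim : ∀ᵐ x ∂μ, Tendsto (fun ε => conj (g ε x)) (𝓝[>] 0) (𝓝 (conj (g₀ x))) := by
    filter_upwards [hlim] with x hx using (Complex.continuous_conj.tendsto _).comp hx
  have hh : Measurable fun x => ((-(g₀ x).im : ℝ) : ℂ) :=
    Complex.measurable_ofReal.comp (Complex.measurable_im.comp hg₀).neg
  have hhM : ∀ n, ∃ M : ℝ, ∀ᵐ x ∂μ, x ∈ R n → ‖((-(g₀ x).im : ℝ) : ℂ)‖ ≤ M := fun n => by
    obtain ⟨M, hM⟩ := hM₀ n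
    refine ⟨M, ?_⟩
    filter_upwards [hM] with x hx hxR
    rw [Complex.norm_real, norm_neg]
    exact (Complex.abs_im_le_norm _).trans (hx hxR)
  have him : ∀ z : ℂ, 1 / (2 * Complex.I) * (conj z - z) = ((-z.im : ℝ) : ℂ) := fun z => by
    have := Complex.sub_conj z
    rw [show conj z - z = -(z - conj z) by ring, this]
    push_cast
    field_simp
  set T₀ := (1 / (2 * Complex.I) : ℂ) • (weakLimit B - weakLimit A)
  have hle : T₀.graph ≤ mulGraph U fun x => ((-(g₀ x).im : ℝ) : ℂ) := by
    rintro ⟨v, w⟩ h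
    obtain ⟨s, t, hs, ht, rfl⟩ := mem_graph_smul_sub.1 h
    rw [weakLimit_graph] at hs ht
    rw [mem_mulGraph, map_smul, map_sub]
    filter_upwards [eq_mul_of_mem_weakLimitGraph U hB hcg hR hae hcM hcg₀ hclim hs,
      eq_mul_of_mem_weakLimitGraph U hA hg hR hae hM hg₀ hlim ht, Lp.coeFn_sub (U s) (U t),
      Lp.coeFn_smul (1 / (2 * Complex.I) : ℂ) (U s - U t)] with x e1 e2 e3 e4
    rw [e4, Pi.smul_apply, e3, Pi.sub_apply, e1, e2, ← sub_mul, smul_eq_mul, ← mul_assoc, him]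
  -- The graph lies in the closed graph of the maximal operator. It contains every pair supported
  -- over a single `R n`, and such pairs are dense in the maximal graph.
  have hclos : T₀.graph.topologicalClosure = mulGraph U fun x => ((-(g₀ x).im : ℝ) : ℂ) := by
    refine le_antisymm (Submodule.topologicalClosure_minimal _ hle
      (isClosed_mulGraph U hh hR hhM hae)) (mulGraph_le_topologicalClosure U hR hae ?_)
    intro v w n hvw hv
    obtain ⟨M, hMn⟩ := hM n
    obtain ⟨M', hMn'⟩ := hcM n
    obtain ⟨M₀, hMn₀⟩ := hM₀ n
    have hcMn₀ : ∀ᵐ x ∂μ, x ∈ R n → ‖conj (g₀ x)‖ ≤ M₀ := by simpa only [RCLike.norm_conj] using hMn₀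
    set t := U.symm (bddMul (memLp_top_indicator hg₀ (hR n) hMn₀) (U v))
    set s := U.symm (bddMul (memLp_top_indicator hcg₀ (hR n) hcMn₀) (U v))
    have ht : U t =ᵐ[μ] fun x => g₀ x * U v x := by
      rw [U.apply_symm_apply]
      filter_upwards [coeFn_bddMul (memLp_top_indicator hg₀ (hR n) hMn₀) (U v), hv] with x e1 e2
      rw [e1]
      by_cases hx : x ∈ R n
      · rw [Set.indicator_of_mem hx]
      · rw [e2 hx, mul_zero, mul_zero]
    have hs : U s =ᵐ[μ] fun x => conj (g₀ x) * U v x := by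
      rw [U.apply_symm_apply]
      filter_upwards [coeFn_bddMul (memLp_top_indicator hcg₀ (hR n) hcMn₀) (U v), hv] with x e1 e2
      rw [e1]
      by_cases hx : x ∈ R n
      · rw [Set.indicator_of_mem hx]
      · rw [e2 hx, mul_zero, mul_zero]
    refine mem_graph_smul_sub.2 ⟨s, t, ?_, ?_, ?_⟩
    · rw [weakLimit_graph]
      exact mem_weakLimitGraph_of_eq_mul U hB hcg hMn' hclim hv hs
    · rw [weakLimit_graph]
      exact mem_weakLimitGraph_of_eq_mul U hA hg hMn hlim hv ht
    · refine U.injective (Lp.ext ?_)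
      rw [map_smul, map_sub]
      filter_upwards [hs, ht, Lp.coeFn_sub (U s) (U t),
        Lp.coeFn_smul (1 / (2 * Complex.I) : ℂ) (U s - U t), (mem_mulGraph U).1 hvw]
        with x e1 e2 e3 e4 e5
      rw [e4, Pi.smul_apply, e3, Pi.sub_apply, e1, e2, ← sub_mul, smul_eq_mul, ← mul_assoc, him, e5]
  -- The multiplication graph is single-valued, hence the graph of an operator.
  have hgraph := Submodule.toLinearPMap_graph_eq (mulGraph U fun x => ((-(g₀ x).im : ℝ) : ℂ)) <| by
    rintro ⟨v, w⟩ hvw (rfl : v = 0)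
    refine (map_eq_zero_iff U U.injective).1 (Lp.ext ?_)
    rw [mem_mulGraph, map_zero] at hvw
    filter_upwards [hvw, Lp.coeFn_zero ℂ 2 μ] with x e1 e2
    rw [e1, e2, Pi.zero_apply, mul_zero]
  -- `LinearPMap.closure` returns the operator unchanged if it is not closable, so closability is
  -- needed to identify its graph.
  have hcl : T₀.IsClosable := ⟨_, hclos.trans hgraph.symm⟩
  rw [← hcl.graph_closure_eq_closure_graph, hclos]

end ImaginaryPart

/-! ### Projections given by indicator functions. -/

section Projection

variable {X : Type*} [MeasurableSpace X] {μ : Measure X}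
  {H : Type*} [NormedAddCommGroup H] [InnerProductSpace ℂ H]

/-- The projection onto a closed subspace whose complement consists of the functions vanishing on
`S` is multiplication by the indicator function of `S`. -/
theorem starProjection_eq_cutoff (U : H ≃ₗᵢ[ℂ] Lp ℂ 2 μ) {S : Set X} (hS : MeasurableSet S)
    (K : Submodule ℂ H) [CompleteSpace K]
    (hK : ∀ v, v ∈ Kᗮ ↔ ∀ᵐ x ∂μ, x ∈ S → U v x = 0) (φ : Lp ℂ 2 μ) :
    U (K.starProjection (U.symm φ)) = cutoff hS φ := by
  rw [← U.apply_symm_apply (cutoff hS φ)]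
  congr 1
  refine Submodule.eq_starProjection_of_mem_orthogonal ?_ ?_
  · rw [← K.orthogonal_orthogonal, Submodule.mem_orthogonal]
    intro v hv
    rw [← U.inner_map_map, U.apply_symm_apply, L2_inner_eq]
    refine integral_eq_zero_of_ae ?_
    filter_upwards [coeFn_cutoff hS φ, (hK v).1 hv] with x e1 e2
    rw [e1]
    by_cases hx : x ∈ S <;> simp [hx, e2]
  · rw [hK, map_sub, U.apply_symm_apply, U.apply_symm_apply]
    filter_upwards [coeFn_cutoff hS φ, Lp.coeFn_sub φ (cutoff hS φ)] with x e1 e2 hx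
    rw [e2, Pi.sub_apply, e1, Set.indicator_of_mem hx, sub_self]

end Projection

/-! ### The boundary function of the fibre integrals. -/

section FibreGreen

variable {ι κ : Type} [Fintype ι] [Fintype κ] {c : (ι ⊕ κ → ℤ) → ℂ} {E : ℝ}

theorem fibreGreen_conj (z : ℂ) (x₁ : UnitAddTorus ι) :
    fibreGreen c (conj z) x₁ = conj (fibreGreen c z x₁) := by
  simp only [fibreGreen, ← integral_conj, map_inv₀, map_sub, Complex.conj_ofReal]

theorem ExpDecay.measurable_fibreGreen (hc : ExpDecay c) (z : ℂ) :
    Measurable (fibreGreen c z) := by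
  have h1 : Measurable fun p : UnitAddTorus ι × UnitAddTorus κ =>
      (Sum.elim p.1 p.2 : UnitAddTorus (ι ⊕ κ)) := by
    refine measurable_pi_iff.2 fun k => ?_
    rcases k with k | k
    · exact (measurable_pi_apply k).comp measurable_fst
    · exact (measurable_pi_apply k).comp measurable_snd
  have h2 : Measurable fun p : UnitAddTorus ι × UnitAddTorus κ =>
      (z - symbol c (Sum.elim p.1 p.2))⁻¹ :=
    (measurable_const.sub (Complex.measurable_ofReal.comp
      (hc.continuous_symbol.measurable.comp h1))).inv
  exact (h2.stronglyMeasurable.integral_prod_right (ν := torusMeasure κ)).measurable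

theorem ExpDecay.ae_eventually_mem_regularSet (hc : ExpDecay c) (hE : NonCritical c E) :
    ∀ᵐ x₁ ∂torusMeasure ι, ∀ᶠ n in atTop, x₁ ∈ regularSet c E n := by
  filter_upwards [hc.ae_mem_regularSet hE] with x₁ ⟨n, hn⟩
  filter_upwards [eventually_ge_atTop n] with m hm using regularSet_mono hm hn

/-- The boundary values of the fibre integrals exist almost everywhere, and their imaginary part
is nonzero exactly on the projection of the level surface. -/
theorem ExpDecay.exists_boundaryValue_fibreGreen (hc : ExpDecay c) (hE : NonCritical c E) :
    ∃ g₀ : UnitAddTorus ι → ℂ, Measurable g₀ ∧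
      (∀ᵐ x₁ ∂torusMeasure ι,
        Tendsto (fun ε : ℝ => fibreGreen c (E + ε * Complex.I) x₁) (𝓝[>] 0) (𝓝 (g₀ x₁))) ∧
      (∀ n, ∃ M : ℝ, ∀ᵐ x₁ ∂torusMeasure ι, x₁ ∈ regularSet c E n → ‖g₀ x₁‖ ≤ M) ∧
      ∀ᵐ x₁ ∂torusMeasure ι, (g₀ x₁).im = 0 ↔ ¬∃ x₂, symbol c (Sum.elim x₁ x₂) = E := by
  -- The limits exist only almost everywhere, fibre by fibre. They are replaced by one measurable
  -- function on the whole torus.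
  obtain ⟨g₀, hg₀, hlim⟩ := measurable_limit_of_tendsto_metrizable_ae (μ := torusMeasure ι)
    (f := fun (ε : ℝ) => fibreGreen c (E + ε * Complex.I)) (L := 𝓝[>] (0 : ℝ))
    (fun ε => (hc.measurable_fibreGreen _).aemeasurable) <| by
      filter_upwards [hc.ae_mem_regularSet hE] with x₁ ⟨n, hn⟩
      exact (hc.fibreGreen_boundaryValues n).2 x₁ hn
  refine ⟨g₀, hg₀, hlim, fun n => ?_, ?_⟩
  · obtain ⟨M, hM⟩ := (hc.fibreGreen_boundaryValues (E := E) n).1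
    refine ⟨M, ?_⟩
    filter_upwards [hlim] with x hx hxR
    refine le_of_tendsto hx.norm ?_
    filter_upwards [Ioc_mem_nhdsGT zero_lt_one] with ε hε using hM x hxR ε hε.1 hε.2
  · filter_upwards [hlim, hc.ae_mem_regularSet hE] with x₁ hx₁ ⟨n, hn⟩
    constructor
    · intro h0 hex
      exact (hc.im_limit_neg hn hex hx₁).ne h0
    · intro h
      exact tendsto_nhds_unique ((Complex.continuous_im.tendsto _).comp hx₁)
        (hc.tendsto_im_fibreGreen_of_notMem fun x₂ hx₂ => h ⟨x₂, hx₂⟩)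

end FibreGreen

/-! ### Spectral representation of the imaginary part and the conclusion. -/

variable {d₁ d₂ : ℕ} {c : (Fin d₁ ⊕ Fin d₂ → ℤ) → ℂ} {E : ℝ}

theorem ExpDecay.measurableSet_levelProjection (hc : ExpDecay c) :
    MeasurableSet (levelProjection c E) :=
  (isClosed_setOf_exists_elim (isClosed_eq hc.continuous_symbol continuous_const)).measurableSet

/-- In the Fourier representation `Im G₀^Λ(E - i0)` is the maximal multiplication operator by a
real function whose zero set is the complement of the projection of the level surface. -/
theorem imGreen_spectralRepresentation (hc : ExpDecay c) (hh : HermitianCoeff c)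
    (hE : NonCritical c E) :
    IsSelfAdjoint (imGreen c E) ∧ ∀ v, v ∈ kernel (imGreen c E) ↔
      ∀ᵐ k₁ ∂torusMeasure (Fin d₁), k₁ ∈ levelProjection c E →
        fourierTransform (Fin d₁) v k₁ = 0 := by
  obtain ⟨g₀, hg₀, hlim, hM₀, hker⟩ := hc.exists_boundaryValue_fibreGreen (E := E) hE
  have hR : ∀ n, MeasurableSet (regularSet c E n) := fun n => (hc.isClosed_regularSet n).measurableSet
  have hae := hc.ae_eventually_mem_regularSet hE
  have hgraph : (imGreen c E).graph =
      mulGraph (fourierTransform (Fin d₁)) fun x => ((-(g₀ x).im : ℝ) : ℂ) := by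
    refine graph_closure_imaginaryPart (fourierTransform (Fin d₁))
      (g := fun ε => fibreGreen c (E + ε * Complex.I)) ?_ ?_
      (fun ε _ => hc.measurable_fibreGreen _) hR hae
      (fun n => (hc.fibreGreen_boundaryValues n).1) hg₀ hlim hM₀
    · intro ε hε u v
      exact inner_greenRestricted hc hh (by simpa using hε.ne') u v
    · intro ε hε u v
      rw [inner_greenRestricted hc hh (by simpa using hε.ne') u v]
      simp only [← fibreGreen_conj, map_add, map_mul, Complex.conj_ofReal, Complex.conj_I, mul_neg,
        ← sub_eq_add_neg]
  have hhm : Measurable fun x => ((-(g₀ x).im : ℝ) : ℂ) :=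
    Complex.measurable_ofReal.comp (Complex.measurable_im.comp hg₀).neg
  refine ⟨isSelfAdjoint_of_graph_eq _ hhm hR (fun n => ?_) hae
    (ae_of_all _ fun x => Complex.conj_ofReal _) hgraph, fun v => ?_⟩
  · obtain ⟨M, hM⟩ := hM₀ n
    refine ⟨M, ?_⟩
    filter_upwards [hM] with x hx hxR
    rw [Complex.norm_real, norm_neg]
    exact (Complex.abs_im_le_norm _).trans (hx hxR)
  · have h1 : v ∈ kernel (imGreen c E) ↔ (v, 0) ∈ (imGreen c E).graph := Iff.rfl
    rw [h1, hgraph, mem_mulGraph, map_zero]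
    constructor
    · intro h
      filter_upwards [h, Lp.coeFn_zero ℂ 2 (torusMeasure (Fin d₁)), hker] with x e1 e2 e3 hx
      rw [e2, Pi.zero_apply, eq_comm, mul_eq_zero, Complex.ofReal_eq_zero, neg_eq_zero] at e1
      exact e1.resolve_left fun h0 => e3.1 h0 hx
    · intro h
      filter_upwards [h, Lp.coeFn_zero ℂ 2 (torusMeasure (Fin d₁)), hker] with x e1 e2 e3
      rw [e2, Pi.zero_apply, eq_comm, mul_eq_zero, Complex.ofReal_eq_zero, neg_eq_zero]
      by_cases hx : x ∈ levelProjection c E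
      · exact Or.inr (e1 hx)
      · exact Or.inl (e3.2 hx)

end LatticeGreen

end

theorem mainTheorem7 (d₁ d₂ : ℕ) (hd₁ : 0 < d₁) (hd₂ : 0 < d₂)
    (c : (Fin d₁ ⊕ Fin d₂ → ℤ) → ℂ)
    (hdecay : LatticeGreen.ExpDecay c) (hherm : LatticeGreen.HermitianCoeff c)
    (E : ℝ) (hE : E ∈ Set.Ioo (LatticeGreen.bandMin c) (LatticeGreen.bandMax c))
    (hcrit : LatticeGreen.NonCritical c E) :
    IsSelfAdjoint (LatticeGreen.imGreen c E) ∧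
    (LatticeGreen.surfaceRange c E)ᗮ = LatticeGreen.kernel (LatticeGreen.imGreen c E) ∧
    (LatticeGreen.kernel (LatticeGreen.imGreen c E) : Set (LatticeGreen.SeqSpace (Fin d₁))) =
      {v | ∀ᵐ k₁ ∂(LatticeGreen.torusMeasure (Fin d₁)), k₁ ∈ LatticeGreen.levelProjection c E →
        LatticeGreen.fourierTransform (Fin d₁) v k₁ = 0} ∧
    ∀ φ : Lp ℂ 2 (LatticeGreen.torusMeasure (Fin d₁)),
      LatticeGreen.fourierTransform (Fin d₁)
          (LatticeGreen.surfaceRangeProj c E ((LatticeGreen.fourierTransform (Fin d₁)).symm φ))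
        =ᵐ[LatticeGreen.torusMeasure (Fin d₁)]
      (LatticeGreen.levelProjection c E).indicator φ := by
  obtain ⟨hsa, hker⟩ := LatticeGreen.imGreen_spectralRepresentation hdecay hherm hcrit
  have hort : (LatticeGreen.surfaceRange c E)ᗮ = LatticeGreen.kernel (LatticeGreen.imGreen c E) :=
    LatticeGreen.orthogonal_closedRange hsa
  refine ⟨hsa, hort, Set.ext hker, fun φ => ?_⟩
  rw [LatticeGreen.surfaceRangeProj, LatticeGreen.starProjection_eq_cutoff
    (LatticeGreen.fourierTransform (Fin d₁)) hdecay.measurableSet_levelProjection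
    (LatticeGreen.surfaceRange c E) (fun v => by rw [hort, hker])]
  exact LatticeGreen.coeFn_cutoff _ φ
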